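/- Let $\mathbb F_q$ be a finite field with $q$ elements, $A=\mathbb F_q[t,t^{-1}]$, $G=\mathrm{GL}_2(A)$, and $G_0=\mathrm{GL}_2(\mathbb F_q)\subset G$. Let $T\subset G$ be the subgroup of all diagonal matrices and $T_0=T\cap G_0$. Write $\delta(a,b)$ for the diagonal matrix with entries $a,b$, and $u=\begin{pmatrix}0&1\\1&0\end{pmatrix}$. Call a subgroup $W\le\mathrm{Aut}(G_0)$ a *group of representatives* if every element of $W$ stabilises $T_0$ and the quotient map $\mathrm{Aut}(G_0)\to\mathrm{Out}(G_0)$ restricts to an isomorphism $W\cong\mathrm{Out}(G_0)$. For such a $W$ let $\mathbb Z_2\times\mathbb Z_2\times\mathrm{Out}(G_0)$ act on $T_0$ as follows: the generator of the first factor acts by inversion, the generator of the second by conjugation by $u$, and an outer class acts by the restriction to $T_0$ of its representative in $W$. Let $\Gamma_W=T_0\rtimes(\mathbb Z_2\times\mathbb Z_2\times\mathrm{Out}(G_0))$ be the resulting semidirect product. (a) Groups of representatives exist. If $q\neq2$, there is one that contains the automorphisms of $G_0$ induced by field automorphisms of $\mathbb F_q$ and the contragredient automorphism $g\mapsto{}^tg^{-1}$.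 (b) Let $W$ be any group of representatives. Then $\Gamma_W$ is finite and $\mathrm{Out}(G)$ is isomorphic to a subgroup of $\Gamma_W$. Moreover, every outer automorphism class of $G$ is represented by a unique automorphism $\phi$ of $G$ such that (i) $\phi(T)=T$ and $\phi(G_0)=G_0$; (ii) $\phi|_{G_0}\in W$; (iii) $\phi(\delta(t,1))=h\,u^i\delta(t^{\varepsilon},1)u^{-i}$ for some $h\in T_0$, $\varepsilon\in\{1,-1\}$, $i\in\{0,1\}$; (iv) $\phi$ has finite order. (c) In particular, $\mathrm{Out}(G)$ is finite. -/

import Mathlib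

open scoped MatrixGroups LaurentPolynomial

/-- The group of inner automorphisms of `G`. -/
def Inn (G : Type*) [Group G] : Subgroup (MulAut G) :=
  (MulAut.conj : G →* MulAut G).range

instance Inn.normal (G : Type*) [Group G] : (Inn G).Normal where
  conj_mem := by
    rintro _ ⟨g, rfl⟩ f
    refine ⟨f g, ?_⟩
    ext x
    simp [MulAut.conj_apply]

/-- The outer automorphism group of `G`. -/
abbrev Out (G : Type*) [Group G] : Type _ := MulAut G ⧸ Inn G

/-- The class in `Out G` of an automorphism. -/
abbrev outClass (G : Type*) [Group G] : MulAut G →* Out G := QuotientGroup.mk' (Inn G)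

section Matrices

/-- The diagonal matrix with diagonal entries `a, b`, as a homomorphism from pairs of units. -/
def diagGL (R : Type*) [CommRing R] : Rˣ × Rˣ →* GL (Fin 2) R where
  toFun x :=
    { val := !![(x.1 : R), 0; 0, (x.2 : R)]
      inv := !![((x.1⁻¹ : Rˣ) : R), 0; 0, ((x.2⁻¹ : Rˣ) : R)]
      val_inv := by ext i j; fin_cases i <;> fin_cases j <;> simp
      inv_val := by ext i j; fin_cases i <;> fin_cases j <;> simp }
  map_one' := by ext i j; fin_cases i <;> fin_cases j <;> simp
  map_mul' x y := by ext i j; fin_cases i <;> fin_cases j <;> simp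

/-- The group of all diagonal matrices in `GL₂(R)`. -/
def torus (R : Type*) [CommRing R] : Subgroup (GL (Fin 2) R) := (diagGL R).range

/-- The permutation matrix `u`, with rows `(0, 1)` and `(1, 0)`. -/
def uGL (R : Type*) [CommRing R] : GL (Fin 2) R where
  val := !![0, 1; 1, 0]
  inv := !![0, 1; 1, 0]
  val_inv := by ext i j; fin_cases i <;> fin_cases j <;> simp
  inv_val := by ext i j; fin_cases i <;> fin_cases j <;> simp

/-- The automorphism of `GL₂(R)` obtained by applying a ring automorphism to the entries. -/
def entryAut {R : Type*} [CommRing R] (ρ : R ≃+* R) : MulAut (GL (Fin 2) R) :=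
  Units.mapEquiv (RingEquiv.mapMatrix ρ).toMulEquiv

/-- The transpose of an invertible matrix. -/
def transposeGL {R : Type*} [CommRing R] (g : GL (Fin 2) R) : GL (Fin 2) R where
  val := (g : Matrix (Fin 2) (Fin 2) R).transpose
  inv := ((g⁻¹ : GL (Fin 2) R) : Matrix (Fin 2) (Fin 2) R).transpose
  val_inv := by rw [← Matrix.transpose_mul, Units.inv_mul, Matrix.transpose_one]
  inv_val := by rw [← Matrix.transpose_mul, Units.mul_inv, Matrix.transpose_one]

/-- The contragredient automorphism of `GL₂(R)`: the inverse of the transpose. -/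
def contragredient (R : Type*) [CommRing R] : MulAut (GL (Fin 2) R) where
  toFun g := (transposeGL g)⁻¹
  invFun g := (transposeGL g)⁻¹
  left_inv g := by ext i j; rfl
  right_inv g := by ext i j; rfl
  map_mul' g h := by
    rw [← mul_inv_rev]
    congr 1
    exact Units.ext (Matrix.transpose_mul _ _)

theorem mem_torus_iff {R : Type*} [CommRing R] (g : GL (Fin 2) R) :
    g ∈ torus R ↔ (g : Matrix (Fin 2) (Fin 2) R) 0 1 = 0 ∧ (g : Matrix (Fin 2) (Fin 2) R) 1 0 = 0 := by
  constructor
  · rintro ⟨x, rfl⟩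
    simp [diagGL]
  · rintro ⟨h1, h2⟩
    have hdet : IsUnit (g.val 0 0 * g.val 1 1) := by
      have h := (Matrix.GeneralLinearGroup.det g).isUnit
      rw [Matrix.GeneralLinearGroup.val_det_apply, Matrix.det_fin_two] at h
      simpa [h1] using h
    rw [IsUnit.mul_iff] at hdet
    refine ⟨(hdet.1.unit, hdet.2.unit), ?_⟩
    ext i j
    fin_cases i <;> fin_cases j <;> simp [diagGL, h1, h2]

theorem uGL_mul_self (R : Type*) [CommRing R] : uGL R * uGL R = 1 :=
  Units.ext (uGL R).val_inv

end Matrices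

section Involution

/-- The homomorphism from the cyclic group of order two determined by an involution. -/
def involHom {M : Type*} [Monoid M] (s : M) (hs : s * s = 1) : Multiplicative (ZMod 2) →* M where
  toFun x := s ^ (Multiplicative.toAdd x).val
  map_one' := by simp
  map_mul' x y := by
    revert x y
    change ∀ x y : ZMod 2, s ^ (x + y).val = s ^ x.val * s ^ y.val
    intro x y
    fin_cases x <;> fin_cases y
    · change s ^ 0 = s ^ 0 * s ^ 0
      simp
    · change s ^ 1 = s ^ 0 * s ^ 1
      simp
    · change s ^ 1 = s ^ 1 * s ^ 0
      simp
    · change s ^ 0 = s ^ 1 * s ^ 1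
      simp [hs]

end Involution

section Restriction

/-- The restriction of an automorphism of `G` to a subgroup that it stabilises. -/
def restrictAut {G : Type*} [Group G] (H : Subgroup G) (f : MulAut G)
    (hf : H.map f.toMonoidHom = H) : MulAut H :=
  (MulEquiv.subgroupMap f H).trans (MulEquiv.subgroupCongr hf)

/-- Restriction to `H`, for a group `W` of automorphisms of `G` that stabilise `H`. -/
def restrictHom {G : Type*} [Group G] (H : Subgroup G) (W : Subgroup (MulAut G))
    (hW : ∀ f ∈ W, H.map f.toMonoidHom = H) : W →* MulAut H where
  toFun f := restrictAut H f (hW f f.2)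
  map_one' := by ext x; rfl
  map_mul' f g := by ext x; rfl

theorem torus_map_conj_uGL (R : Type*) [CommRing R] :
    (torus R).map (MulAut.conj (uGL R)).toMonoidHom = torus R := by
  have key : ∀ g ∈ torus R, uGL R * g * (uGL R)⁻¹ ∈ torus R := by
    intro g hg
    have hu : (uGL R)⁻¹ = uGL R := inv_eq_of_mul_eq_one_left (uGL_mul_self R)
    rw [mem_torus_iff] at hg
    rw [hu, mem_torus_iff]
    simp [uGL, Matrix.mul_apply, Matrix.vecMul, dotProduct, Fin.sum_univ_two, hg.1, hg.2]
  apply le_antisymm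
  · rintro _ ⟨g, hg, rfl⟩
    exact key g hg
  · intro g hg
    refine ⟨uGL R * g * (uGL R)⁻¹, key g hg, ?_⟩
    have hu : (uGL R)⁻¹ = uGL R := inv_eq_of_mul_eq_one_left (uGL_mul_self R)
    change uGL R * (uGL R * g * (uGL R)⁻¹) * (uGL R)⁻¹ = g
    rw [hu]
    calc uGL R * (uGL R * g * uGL R) * uGL R = (uGL R * uGL R) * g * (uGL R * uGL R) := by group
      _ = g := by rw [uGL_mul_self]; simp

/-- Conjugation by `u` on the group of diagonal matrices. -/
def torusSwap (R : Type*) [CommRing R] : MulAut (torus R) :=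
  restrictAut (torus R) (MulAut.conj (uGL R)) (torus_map_conj_uGL R)

theorem torus_comm {R : Type*} [CommRing R] (x y : torus R) : x * y = y * x := by
  obtain ⟨_, a, rfl⟩ := x
  obtain ⟨_, b, rfl⟩ := y
  apply Subtype.ext
  change diagGL R a * diagGL R b = diagGL R b * diagGL R a
  rw [← map_mul, ← map_mul, mul_comm]

/-- Inversion on the (commutative) group of diagonal matrices. -/
def torusInv (R : Type*) [CommRing R] : MulAut (torus R) where
  toFun x := x⁻¹
  invFun x := x⁻¹
  left_inv x := inv_inv x
  right_inv x := inv_inv x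
  map_mul' x y := by rw [mul_inv_rev, torus_comm]

theorem torusInv_mul_self (R : Type*) [CommRing R] : torusInv R * torusInv R = 1 := by
  ext x : 1
  exact inv_inv x

theorem torusSwap_mul_self (R : Type*) [CommRing R] : torusSwap R * torusSwap R = 1 := by
  ext x : 1
  apply Subtype.ext
  change uGL R * (uGL R * x.1 * (uGL R)⁻¹) * (uGL R)⁻¹ = x.1
  have hu : (uGL R)⁻¹ = uGL R := inv_eq_of_mul_eq_one_left (uGL_mul_self R)
  rw [hu]
  calc uGL R * (uGL R * x.1 * uGL R) * uGL R
        = (uGL R * uGL R) * x.1 * (uGL R * uGL R) := by group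
    _ = x.1 := by rw [uGL_mul_self]; simp

theorem torusInv_commute {R : Type*} [CommRing R] (f : MulAut (torus R)) :
    Commute (torusInv R) f := by
  ext x : 1
  exact (map_inv f x).symm

/-- An element that normalises the diagonal torus over a field and lies outside of the torus
acts on the torus in the same way as `u`. -/
theorem conj_eq_conj_uGL {F : Type*} [Field F] (M : GL (Fin 2) F)
    (hM : ∀ g ∈ torus F, M * g * M⁻¹ ∈ torus F) (hM' : M ∉ torus F) (g : GL (Fin 2) F)
    (hg : g ∈ torus F) : M * g * M⁻¹ = uGL F * g * (uGL F)⁻¹ := by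
  by_cases ha : ∃ a : Fˣ, a ≠ 1
  · obtain ⟨a, ha⟩ := ha
    have ha' : (a : F) - 1 ≠ 0 := by
      intro h
      exact ha (Units.ext (by simpa using sub_eq_zero.mp h))
    obtain ⟨⟨d, e⟩, hd⟩ := hM (diagGL F (a, 1)) ⟨_, rfl⟩
    have hd' : diagGL F (d, e) * M = M * diagGL F (a, 1) := by rw [hd]; group
    have hent : ∀ i j, (diagGL F (d, e) * M).val i j = (M * diagGL F (a, 1)).val i j := by
      intro i j; rw [hd']
    have h00 := hent 0 0
    have h01 := hent 0 1
    have h10 := hent 1 0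
    have h11 := hent 1 1
    simp only [diagGL, Units.val_mul, MonoidHom.coe_mk, OneHom.coe_mk, Matrix.mul_apply,
      Fin.sum_univ_two, Matrix.of_apply, Matrix.cons_val', Matrix.cons_val_zero,
      Matrix.cons_val_one, Matrix.cons_val_fin_one, zero_mul, mul_zero, add_zero, zero_add,
      Units.val_one, mul_one] at h00 h01 h10 h11
    have hdet : M.val 0 0 * M.val 1 1 - M.val 0 1 * M.val 1 0 ≠ 0 := by
      have h := (Matrix.GeneralLinearGroup.det M).ne_zero
      rwa [Matrix.GeneralLinearGroup.val_det_apply, Matrix.det_fin_two] at h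
    rw [mem_torus_iff] at hM'
    have hz : M.val 0 0 = 0 ∧ M.val 1 1 = 0 := by
      have hrow0 : M.val 0 0 = 0 ∨ M.val 0 1 = 0 := by
        have h : ((a : F) - 1) * (M.val 0 0 * M.val 0 1) = 0 := by
          linear_combination M.val 0 0 * h01 - M.val 0 1 * h00
        simpa [ha'] using h
      have hrow1 : M.val 1 0 = 0 ∨ M.val 1 1 = 0 := by
        have h : ((a : F) - 1) * (M.val 1 0 * M.val 1 1) = 0 := by
          linear_combination M.val 1 0 * h11 - M.val 1 1 * h10
        simpa [ha'] using h
      rcases hrow0 with h | h <;> rcases hrow1 with h' | h'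
      · simp [h, h'] at hdet
      · exact ⟨h, h'⟩
      · exact absurd ⟨h, h'⟩ hM'
      · simp [h, h'] at hdet
    have hu : (uGL F)⁻¹ = uGL F := inv_eq_of_mul_eq_one_left (uGL_mul_self F)
    rw [mul_inv_eq_iff_eq_mul, hu]
    rw [mem_torus_iff] at hg
    ext i j
    fin_cases i <;> fin_cases j <;>
      simp [uGL, Matrix.mul_apply, Matrix.vecMul, dotProduct, Fin.sum_univ_two, hg.1, hg.2, hz.1, hz.2, mul_comm]
  · push Not at ha
    obtain ⟨⟨a, b⟩, rfl⟩ := hg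
    rw [ha a, ha b]
    have h1 : diagGL F (1, 1) = 1 := map_one (diagGL F)
    rw [h1]
    simp

theorem torusSwap_commute {F : Type*} [Field F] (f : MulAut (GL (Fin 2) F))
    (hf : (torus F).map f.toMonoidHom = torus F) :
    Commute (torusSwap F) (restrictAut (torus F) f hf) := by
  have hmem : ∀ g, f g ∈ torus F ↔ g ∈ torus F := by
    intro g
    constructor
    · intro h
      rw [← hf] at h
      obtain ⟨g', hg', h⟩ := h
      rwa [← f.injective h]
    · intro h
      rw [← hf]
      exact ⟨g, h, rfl⟩
  have hu : uGL F ∉ torus F := by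
    rw [mem_torus_iff]
    simp [uGL]
  have hconj : ∀ g ∈ torus F, f (uGL F) * g * (f (uGL F))⁻¹ ∈ torus F := by
    intro g hg
    rw [← hf] at hg
    obtain ⟨g', hg', rfl⟩ := hg
    change f (uGL F) * f g' * (f (uGL F))⁻¹ ∈ torus F
    rw [← map_inv, ← map_mul, ← map_mul, hmem]
    exact (torusSwap F ⟨g', hg'⟩).2
  ext x : 1
  apply Subtype.ext
  change uGL F * f x.1 * (uGL F)⁻¹ = f (uGL F * x.1 * (uGL F)⁻¹)
  rw [map_mul, map_mul, map_inv]
  exact (conj_eq_conj_uGL (f (uGL F)) hconj (by rwa [hmem]) (f x.1) ((hmem _).mpr x.2)).symm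

end Restriction

section Gamma

/-- `W` is a group of automorphisms of `GL₂(F)` that stabilise the diagonal torus, and it contains
exactly one representative of each outer automorphism class. -/
structure RepresentsOut (F : Type*) [Field F] (W : Subgroup (MulAut (GL (Fin 2) F))) : Prop where
  stabilises : ∀ f ∈ W, (torus F).map f.toMonoidHom = torus F
  bijective : Function.Bijective ((outClass (GL (Fin 2) F)).comp W.subtype)

/-- The group generated by the automorphisms of `GL₂(F)` that are induced by automorphisms of `F`
and by the contragredient automorphism. -/
def frobeniusContragredient (F : Type*) [Field F] : Subgroup (MulAut (GL (Fin 2) F)) :=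
  Subgroup.closure (Set.range (entryAut (R := F)) ∪ {contragredient F})

variable {F : Type*} [Field F] {W : Subgroup (MulAut (GL (Fin 2) F))}

/-- The identification of `Out(GL₂(F))` with the group `W` of representatives. -/
noncomputable def RepresentsOut.equiv (hW : RepresentsOut F W) : W ≃* Out (GL (Fin 2) F) :=
  MulEquiv.ofBijective _ hW.bijective

/-- The action of `Z₂ × Z₂ × Out(GL₂(F))` on the diagonal torus: the first factor acts by
inversion, the second by conjugation by `u`, and an outer class by its representative in `W`. -/
noncomputable def RepresentsOut.action (hW : RepresentsOut F W) :
    Multiplicative (ZMod 2) × Multiplicative (ZMod 2) × Out (GL (Fin 2) F) →*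
      MulAut (torus F) :=
  (involHom (torusInv F) (torusInv_mul_self F)).noncommCoprod
    ((involHom (torusSwap F) (torusSwap_mul_self F)).noncommCoprod
      ((restrictHom (torus F) W hW.stabilises).comp hW.equiv.symm.toMonoidHom)
      (fun _ _ => (torusSwap_commute _ _).pow_left _))
    (fun _ _ => (torusInv_commute _).pow_left _)

/-- The semidirect product of the diagonal torus of `GL₂(F)` and `Z₂ × Z₂ × Out(GL₂(F))`. -/
abbrev RepresentsOut.Gamma (hW : RepresentsOut F W) : Type _ :=
  torus F ⋊[hW.action] (Multiplicative (ZMod 2) × Multiplicative (ZMod 2) × Out (GL (Fin 2) F))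

end Gamma

section Laurent

variable (F : Type*) [Field F]

/-- The inclusion of `GL₂(F)` into `GL₂(F[t,t⁻¹])` as matrices with constant entries. -/
noncomputable def constGL : GL (Fin 2) F →* GL (Fin 2) F[T;T⁻¹] :=
  Matrix.GeneralLinearGroup.map LaurentPolynomial.C

/-- The unit `t` of `F[t,t⁻¹]`. -/
noncomputable def tUnit : (F[T;T⁻¹])ˣ where
  val := LaurentPolynomial.T 1
  inv := LaurentPolynomial.T (-1)
  val_inv := by rw [← LaurentPolynomial.T_add]; simp
  inv_val := by rw [← LaurentPolynomial.T_add]; simp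

variable {F}

/-- `φ(δ(t,1)) = h · uⁱ δ(t^ε,1) u⁻ⁱ`, where `δ(a,b)` is the diagonal matrix with entries `a, b`,
for `h` a constant diagonal matrix, a sign `ε` and `i ∈ {0,1}`. -/
def IsOfType (φ : MulAut (GL (Fin 2) F[T;T⁻¹])) (h : torus F) (ε : ℤˣ) (i : Fin 2) : Prop :=
  φ (diagGL F[T;T⁻¹] (tUnit F, 1)) =
    constGL F h * (uGL F[T;T⁻¹] ^ (i : ℕ) * diagGL F[T;T⁻¹] (tUnit F ^ (ε : ℤ), 1) *
      (uGL F[T;T⁻¹] ^ (i : ℕ))⁻¹)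

/-- `φ` stabilises the diagonal torus and the subgroup `GL₂(F)` of constant matrices, it restricts
on the latter to a member of `W`, it has a type, and it has finite order. -/
structure IsNormalised (W : Subgroup (MulAut (GL (Fin 2) F)))
    (φ : MulAut (GL (Fin 2) F[T;T⁻¹])) : Prop where
  torus_map : (torus F[T;T⁻¹]).map φ.toMonoidHom = torus F[T;T⁻¹]
  const_map : (constGL F).range.map φ.toMonoidHom = (constGL F).range
  restrict : ∃ f ∈ W, ∀ g, φ (constGL F g) = constGL F (f g)
  type : ∃ h ε i, IsOfType φ h ε i
  finite_order : IsOfFinOrder φ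

end Laurent

/-!
Write `G₀ = GL₂(F) ⊂ G = GL₂(F[t,t⁻¹])`, `x = 1 + E₁₂`, `y = 1 + E₂₁`, `D = δ(t,1)`, and let `T` be
the diagonal torus of `G`.

**Automorphisms of `G` stabilise `G₀`, up to conjugation.** Let `φ` be an embedding of `G₀` into
`G`. The matrices `N = φ(x) - 1` and `M = φ(y) - 1` are nilpotent and do not commute, so
`tr(NM) ≠ 0`. A matrix of finite order has constant trace (`exists_trace_eq_C_of_isOfFinOrder`), so
`c = tr(NM)` is a unit, and `N`, `M` generate a full matrix algebra. Since `F[t,t⁻¹]` is a principal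
ideal domain, `N` and `M` are conjugate to `E₁₂` and `c E₂₁` (`exists_conj_matrix_units`). After
this conjugation the entries of `φ(k)`, for `k ∈ G₀`, are combinations of traces of matrices of
finite order, hence constant. So an automorphism of `G` can be composed with an inner one such that
it stabilises `G₀` and restricts to a member of `W` there. Specialising `t` to `1` shows that this
normalised representative is unique (`eq_of_mem_constRestrict`).

**Normalised automorphisms.** They stabilise `T` (`mem_torus_of_mem_constRestrict`), and modulo
constants they act on it by an invertible integral matrix that commutes with the swap of the
coordinates. This leaves four possibilities for `φ(D)` up to constants
(`map_diagGL_tUnit_cases`), so `φ` has a type. If `φ(D) = s(h D)` with `s` in the group `Z₂ × Z₂` of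
inversion and swap, then `φ ↦ (h, s, φ|G₀)` is multiplicative, as `φ` commutes with `s` on `T`. It
is injective, as `G₀` and `D` generate `G` (`eq_top_of_constGL_mem`, by column reduction). So
`Out(G)` embeds in the finite group `Γ_W`, and the uniqueness of normalised representatives makes
their orders finite.

**Groups of representatives.** The same conjugation argument over `F` shows that an automorphism of
`G₀` is, up to an inner one, of the form `g ↦ χ(det g) ρ(g)` with a field automorphism `ρ`
(`exists_conj_mul_eq_detTwist_mul_entryAut`). Here `χ(a) = aᵏ`, and `2k + 1` runs over the units
modulo `2n`, for `n = |Fˣ|`. These maps represent `Out(G₀)`, but the contragredient is not among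
them: it is the one for `k = -1`, followed by conjugation by the matrix `s` with rows `(0, 1)` and
`(-1, 0)`. If `|F| > 2`, there is a quadratic character `θ` modulo `2n` with `θ(-1) = -1`
(`exists_odd_character`). As `s` is fixed by all the maps above, they still form a group of
representatives after those with `θ(2k + 1) = -1` are followed by conjugation by `s`.
-/

/-! ### Elementary and diagonal `2 × 2` matrices -/

section TwoByTwo

variable {R : Type*} [CommRing R]

/-- The unipotent matrix with rows `(1, a)` and `(0, 1)`. -/
def upperGL (a : R) : GL (Fin 2) R where
  val := !![1, a; 0, 1]
  inv := !![1, -a; 0, 1]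
  val_inv := by ext i j; fin_cases i <;> fin_cases j <;> simp
  inv_val := by ext i j; fin_cases i <;> fin_cases j <;> simp

/-- The unipotent matrix with rows `(1, 0)` and `(a, 1)`. -/
def lowerGL (a : R) : GL (Fin 2) R where
  val := !![1, 0; a, 1]
  inv := !![1, 0; -a, 1]
  val_inv := by ext i j; fin_cases i <;> fin_cases j <;> simp
  inv_val := by ext i j; fin_cases i <;> fin_cases j <;> simp

theorem coe_upperGL (a : R) : (upperGL a : Matrix (Fin 2) (Fin 2) R) = !![1, a; 0, 1] := rfl

theorem coe_lowerGL (a : R) : (lowerGL a : Matrix (Fin 2) (Fin 2) R) = !![1, 0; a, 1] := rfl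

theorem coe_diagGL (x : Rˣ × Rˣ) :
    (diagGL R x : Matrix (Fin 2) (Fin 2) R) = !![(x.1 : R), 0; 0, (x.2 : R)] := rfl

theorem coe_uGL : (uGL R : Matrix (Fin 2) (Fin 2) R) = !![0, 1; 1, 0] := rfl

theorem GL_ext {g h : GL (Fin 2) R} (h00 : g.val 0 0 = h.val 0 0) (h01 : g.val 0 1 = h.val 0 1)
    (h10 : g.val 1 0 = h.val 1 0) (h11 : g.val 1 1 = h.val 1 1) : g = h := by
  ext i j
  fin_cases i <;> fin_cases j <;> assumption

theorem GL_ext_iff (g h : GL (Fin 2) R) : g = h ↔ (g.val 0 0 = h.val 0 0 ∧ g.val 0 1 = h.val 0 1) ∧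
    g.val 1 0 = h.val 1 0 ∧ g.val 1 1 = h.val 1 1 :=
  ⟨by rintro rfl; simp, fun h => GL_ext h.1.1 h.1.2 h.2.1 h.2.2⟩

theorem mul_val_apply (g h : GL (Fin 2) R) (i j : Fin 2) :
    (g * h).val i j = g.val i 0 * h.val 0 j + g.val i 1 * h.val 1 j := by
  rw [Units.val_mul, Matrix.mul_apply, Fin.sum_univ_two]

theorem upperGL_mul (a b : R) : upperGL a * upperGL b = upperGL (a + b) := by
  apply GL_ext <;> simp [mul_val_apply, coe_upperGL, add_comm]

theorem lowerGL_mul (a b : R) : lowerGL a * lowerGL b = lowerGL (a + b) := by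
  apply GL_ext <;> simp [mul_val_apply, coe_lowerGL]

theorem upperGL_zero : upperGL (0 : R) = 1 := by
  apply GL_ext <;> simp [coe_upperGL]

theorem lowerGL_zero : lowerGL (0 : R) = 1 := by
  apply GL_ext <;> simp [coe_lowerGL]

theorem lowerGL_inv (a : R) : (lowerGL a)⁻¹ = lowerGL (-a) :=
  inv_eq_of_mul_eq_one_left (by rw [lowerGL_mul, neg_add_cancel, lowerGL_zero])

theorem upperGL_injective : Function.Injective (upperGL : R → GL (Fin 2) R) := fun a b h => by
  simpa [coe_upperGL] using congrArg (fun g : GL (Fin 2) R => g.val 0 1) h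

theorem upperGL_pow (a : R) (n : ℕ) : upperGL a ^ n = upperGL (n * a) := by
  induction n with
  | zero => simp [upperGL_zero]
  | succ n ih => rw [pow_succ, ih, upperGL_mul]; congr 1; push_cast; ring

theorem lowerGL_pow (a : R) (n : ℕ) : lowerGL a ^ n = lowerGL (n * a) := by
  induction n with
  | zero => simp [lowerGL_zero]
  | succ n ih => rw [pow_succ, ih, lowerGL_mul]; congr 1; push_cast; ring

theorem diagGL_mul_upperGL (a b : Rˣ) (r : R) :
    diagGL R (a, b) * upperGL r = upperGL (a * r * (b⁻¹ : Rˣ)) * diagGL R (a, b) := by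
  apply GL_ext <;> simp [mul_val_apply, coe_upperGL, coe_diagGL]

theorem diagGL_mul_lowerGL (a b : Rˣ) (r : R) :
    diagGL R (a, b) * lowerGL r = lowerGL (b * r * (a⁻¹ : Rˣ)) * diagGL R (a, b) := by
  apply GL_ext <;> simp [mul_val_apply, coe_lowerGL, coe_diagGL]

theorem uGL_inv : (uGL R)⁻¹ = uGL R := inv_eq_of_mul_eq_one_left (uGL_mul_self R)

theorem det_val (g : GL (Fin 2) R) :
    ((Matrix.GeneralLinearGroup.det g : Rˣ) : R) =
      g.val 0 0 * g.val 1 1 - g.val 0 1 * g.val 1 0 := by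
  rw [Matrix.GeneralLinearGroup.val_det_apply, Matrix.det_fin_two]

theorem uGL_conj_diagGL (a b : Rˣ) :
    uGL R * diagGL R (a, b) * (uGL R)⁻¹ = diagGL R (b, a) := by
  rw [uGL_inv]
  apply GL_ext <;> simp [mul_val_apply, coe_uGL, coe_diagGL]

theorem diagGL_injective : Function.Injective (diagGL R) := by
  rintro ⟨a, b⟩ ⟨c, d⟩ h
  have h0 := congrArg (fun g : GL (Fin 2) R => g.val 0 0) h
  have h1 := congrArg (fun g : GL (Fin 2) R => g.val 1 1) h
  simp only [coe_diagGL, Matrix.of_apply, Matrix.cons_val', Matrix.cons_val_zero,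
    Matrix.cons_val_one, Matrix.cons_val_fin_one] at h0 h1
  exact Prod.ext (Units.ext h0) (Units.ext h1)

/-- A matrix that commutes with the two elementary unipotent matrices is scalar, hence central. -/
theorem mem_center_of_commute_unipotents {c : R} (hc : IsUnit c) {g : GL (Fin 2) R}
    (h1 : g * upperGL 1 = upperGL 1 * g) (h2 : g * lowerGL c = lowerGL c * g) :
    ∃ a : Rˣ, g = diagGL R (a, a) := by
  rw [GL_ext_iff] at h1 h2
  simp only [mul_val_apply, coe_upperGL, coe_lowerGL, Matrix.of_apply, Matrix.cons_val',
    Matrix.cons_val_zero, Matrix.cons_val_one, Matrix.cons_val_fin_one] at h1 h2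
  obtain ⟨⟨e1, e2⟩, -⟩ := h1
  obtain ⟨⟨e3, -⟩, -⟩ := h2
  have h01 : g.val 0 1 = 0 := by
    have : g.val 0 1 * c = 0 := by linear_combination e3
    exact (hc.mul_left_eq_zero).mp this
  have h10 : g.val 1 0 = 0 := by linear_combination -e1
  have h11 : g.val 0 0 = g.val 1 1 := by linear_combination e2
  obtain ⟨⟨a, b⟩, rfl⟩ := (mem_torus_iff g).mpr ⟨h01, h10⟩
  refine ⟨a, ?_⟩
  congr 2
  exact Units.ext (by simpa [coe_diagGL] using h11.symm)

theorem commute_scalar (a : Rˣ) (g : GL (Fin 2) R) : diagGL R (a, a) * g = g * diagGL R (a, a) := by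
  apply GL_ext <;> simp [mul_val_apply, coe_diagGL, mul_comm]

/-- The diagonal torus in terms of the two elementary unipotent matrices `x` and `y` alone: it
consists of the `g` for which `g x g⁻¹` commutes with `x` and `g y g⁻¹` commutes with `y`. -/
theorem mem_torus_iff_commute [IsDomain R] {c : R} (hc : c ≠ 0) (g : GL (Fin 2) R) :
    g ∈ torus R ↔ Commute (g * upperGL 1 * g⁻¹) (upperGL 1) ∧
      Commute (g * lowerGL c * g⁻¹) (lowerGL c) := by
  constructor
  · rintro ⟨⟨a, b⟩, rfl⟩
    rw [diagGL_mul_upperGL, diagGL_mul_lowerGL, mul_inv_cancel_right, mul_inv_cancel_right]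
    constructor
    · rw [commute_iff_eq, upperGL_mul, upperGL_mul, add_comm]
    · rw [commute_iff_eq, lowerGL_mul, lowerGL_mul, add_comm]
  · rintro ⟨h1, h2⟩
    obtain ⟨d, hd⟩ : ∃ d : Rˣ, d = Matrix.GeneralLinearGroup.det g := ⟨_, rfl⟩
    have hinv : ∀ i j, (g⁻¹).val i j = ((d⁻¹ : Rˣ) : R) * g.val.adjugate i j := by
      intro i j
      rw [Matrix.coe_units_inv, Matrix.inv_def, Matrix.smul_apply, smul_eq_mul, hd,
        ← Matrix.GeneralLinearGroup.val_det_apply, Ring.inverse_unit]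
    have e1 := congrArg (fun g : GL (Fin 2) R => g.val 0 0) h1.eq
    have e2 := congrArg (fun g : GL (Fin 2) R => g.val 0 0) h2.eq
    have hdet := det_val g
    rw [← hd] at hdet
    simp only [mul_val_apply, coe_upperGL, coe_lowerGL, hinv, Matrix.adjugate_fin_two,
      Matrix.of_apply, Matrix.cons_val', Matrix.cons_val_zero, Matrix.cons_val_one,
      Matrix.cons_val_fin_one] at e1 e2
    have hd0 : ((d⁻¹ : Rˣ) : R) ≠ 0 := Units.ne_zero _
    rw [mem_torus_iff]
    constructor
    · have : ((d⁻¹ : Rˣ) : R) * c ^ 2 * g.val 0 1 ^ 2 = 0 := by linear_combination -e2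
      simpa [hd0, hc] using this
    · have : ((d⁻¹ : Rˣ) : R) * g.val 1 0 ^ 2 = 0 := by linear_combination e1
      simpa [hd0] using this

/-- A matrix that conjugates one diagonal matrix with distinct entries into the torus is diagonal
or antidiagonal. -/
theorem mem_torus_or_antidiagonal [IsDomain R] {a b : Rˣ} (hab : a ≠ b) {M : GL (Fin 2) R}
    (hM : M * diagGL R (a, b) * M⁻¹ ∈ torus R) :
    M ∈ torus R ∨ M.val 0 0 = 0 ∧ M.val 1 1 = 0 := by
  obtain ⟨⟨d, e⟩, hd⟩ := hM
  have hd' : diagGL R (d, e) * M = M * diagGL R (a, b) := by rw [hd]; group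
  have hab' : (a : R) - b ≠ 0 := fun h => hab (Units.ext (sub_eq_zero.mp h))
  rw [GL_ext_iff] at hd'
  simp only [mul_val_apply, coe_diagGL, Matrix.of_apply, Matrix.cons_val',
    Matrix.cons_val_zero, Matrix.cons_val_one, Matrix.cons_val_fin_one] at hd'
  obtain ⟨⟨h00, h01⟩, h10, h11⟩ := hd'
  have hdet : M.val 0 0 * M.val 1 1 - M.val 0 1 * M.val 1 0 ≠ 0 := by
    rw [← det_val]; exact Units.ne_zero _
  have hrow0 : M.val 0 0 = 0 ∨ M.val 0 1 = 0 := by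
    have h : ((a : R) - b) * (M.val 0 0 * M.val 0 1) = 0 := by
      linear_combination M.val 0 0 * h01 - M.val 0 1 * h00
    simpa [hab'] using h
  have hrow1 : M.val 1 0 = 0 ∨ M.val 1 1 = 0 := by
    have h : ((a : R) - b) * (M.val 1 0 * M.val 1 1) = 0 := by
      linear_combination M.val 1 0 * h11 - M.val 1 1 * h10
    simpa [hab'] using h
  rw [mem_torus_iff]
  rcases hrow0 with h | h <;> rcases hrow1 with h' | h'
  · simp [h, h'] at hdet
  · exact Or.inr ⟨h, h'⟩
  · exact Or.inl ⟨h, h'⟩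
  · simp [h, h'] at hdet

theorem antidiagonal_conj {M : GL (Fin 2) R} (h0 : M.val 0 0 = 0) (h1 : M.val 1 1 = 0)
    (a b : Rˣ) : M * diagGL R (a, b) * M⁻¹ = diagGL R (b, a) := by
  rw [mul_inv_eq_iff_eq_mul]
  apply GL_ext <;> simp [mul_val_apply, coe_diagGL, h0, h1, mul_comm]

end TwoByTwo

/-! ### Pairs of nilpotent matrices -/

section NilpotentPairs

variable {R : Type*} [CommRing R]

theorem mul_self_eq_zero_of_trace_det {N : Matrix (Fin 2) (Fin 2) R} (htr : N.trace = 0)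
    (hdet : N.det = 0) : N * N = 0 := by
  rw [Matrix.trace_fin_two] at htr
  rw [Matrix.det_fin_two] at hdet
  ext i j
  fin_cases i <;> fin_cases j <;>
    simp only [Matrix.mul_apply, Fin.sum_univ_two, Matrix.zero_apply, Fin.zero_eta, Fin.mk_one]
  · linear_combination N 0 0 * htr - hdet
  · linear_combination N 0 1 * htr
  · linear_combination N 1 0 * htr
  · linear_combination N 1 1 * htr - hdet

theorem trace_det_eq_zero_of_isNilpotent [IsDomain R] {N : Matrix (Fin 2) (Fin 2) R}
    (hN : IsNilpotent N) : N.trace = 0 ∧ N.det = 0 := by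
  refine ⟨(Matrix.isNilpotent_trace_of_isNilpotent hN).eq_zero, ?_⟩
  obtain ⟨k, hk⟩ := hN
  have : N.det ^ (k + 1) = 0 := by rw [← Matrix.det_pow, pow_succ, hk]; simp
  exact pow_eq_zero_iff (Nat.succ_ne_zero k) |>.mp this

/-- Two nilpotent `2 × 2` matrices over a domain whose product has trace zero have the same kernel,
hence commute. -/
theorem commute_of_trace_mul_eq_zero [IsDomain R] {N M : Matrix (Fin 2) (Fin 2) R}
    (hN : N.trace = 0) (hN' : N.det = 0) (hM : M.trace = 0) (hM' : M.det = 0)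
    (h : (N * M).trace = 0) : N * M = M * N := by
  rw [Matrix.trace_fin_two] at hN hM h
  rw [Matrix.det_fin_two] at hN' hM'
  simp only [Matrix.mul_apply, Fin.sum_univ_two] at h
  have hn : N 1 1 = -N 0 0 := by linear_combination hN
  have hm : M 1 1 = -M 0 0 := by linear_combination hM
  rw [hn] at hN' h
  rw [hm] at hM' h
  -- the three entries of the commutator have square zero
  have h1 : N 0 1 * M 1 0 - N 1 0 * M 0 1 = 0 := by
    refine pow_eq_zero_iff (two_ne_zero) |>.mp ?_
    linear_combination (N 0 1 * M 1 0 + N 1 0 * M 0 1 - 2 * N 0 0 * M 0 0) * h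
      + 4 * M 0 1 * M 1 0 * hN' - 4 * (N 0 0) ^ 2 * hM'
  have h2 : N 0 0 * M 0 1 - N 0 1 * M 0 0 = 0 := by
    refine pow_eq_zero_iff (two_ne_zero) |>.mp ?_
    linear_combination -N 0 1 * M 0 1 * h - (M 0 1) ^ 2 * hN' - (N 0 1) ^ 2 * hM'
  have h3 : N 1 0 * M 0 0 - N 0 0 * M 1 0 = 0 := by
    refine pow_eq_zero_iff (two_ne_zero) |>.mp ?_
    linear_combination -N 1 0 * M 1 0 * h - (M 1 0) ^ 2 * hN' - (N 1 0) ^ 2 * hM'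
  ext i j
  fin_cases i <;> fin_cases j <;>
    simp only [Matrix.mul_apply, Fin.sum_univ_two, Fin.zero_eta, Fin.mk_one, hn, hm]
  · linear_combination h1
  · linear_combination 2 * h2
  · linear_combination 2 * h3
  · linear_combination -h1

/-- Over a principal ideal domain, an idempotent `2 × 2` matrix of rank one is the product of a
column and a row: its image is a free direct summand of rank one. -/
theorem exists_vecMulVec_of_idempotent [IsDomain R] [IsPrincipalIdealRing R]
    {e : Matrix (Fin 2) (Fin 2) R} (htr : e.trace = 1) (hdet : e.det = 0) :
    ∃ v w : Fin 2 → R, e = Matrix.vecMulVec v w ∧ w ⬝ᵥ v = 1 := by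
  rw [Matrix.trace_fin_two] at htr
  rw [Matrix.det_fin_two] at hdet
  obtain ⟨d, hd⟩ := IsPrincipalIdealRing.principal (Ideal.span {e 0 0, e 1 0})
  have hd' : Ideal.span {e 0 0, e 1 0} = Ideal.span {d} := hd
  have h0 : d ∣ e 0 0 := Ideal.mem_span_singleton.mp
    (hd' ▸ Ideal.subset_span (Set.mem_insert _ _))
  have h1 : d ∣ e 1 0 := Ideal.mem_span_singleton.mp
    (hd' ▸ Ideal.subset_span (Set.mem_insert_of_mem _ rfl))
  obtain ⟨r, s, hrs⟩ := Ideal.mem_span_pair.mp (hd' ▸ Ideal.mem_span_singleton_self d)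
  obtain ⟨a, ha⟩ := h0
  obtain ⟨c, hc⟩ := h1
  by_cases hd0 : d = 0
  · have e00 : e 0 0 = 0 := by rw [ha, hd0, zero_mul]
    have e10 : e 1 0 = 0 := by rw [hc, hd0, zero_mul]
    have e11 : e 1 1 = 1 := by rw [← htr, e00, zero_add]
    refine ⟨![e 0 1, 1], ![0, 1], ?_, ?_⟩
    · ext i j
      fin_cases i <;> fin_cases j <;> simp [Matrix.vecMulVec_apply, e00, e10, e11]
    · simp
  · have hco : r * a + s * c = 1 := by
      apply mul_left_cancel₀ hd0
      linear_combination hrs - r * ha - s * hc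
    have hz : a * e 1 1 = e 0 1 * c := by
      apply mul_left_cancel₀ hd0
      linear_combination hdet - e 1 1 * ha + e 0 1 * hc
    have ha' : e 0 1 = a * (r * e 0 1 + s * e 1 1) := by
      linear_combination -e 0 1 * hco - s * hz
    have hc' : e 1 1 = c * (r * e 0 1 + s * e 1 1) := by
      linear_combination -e 1 1 * hco + r * hz
    refine ⟨![a, c], ![d, r * e 0 1 + s * e 1 1], ?_, ?_⟩
    · ext i j
      fin_cases i <;> fin_cases j <;> simp [Matrix.vecMulVec_apply]
      · rw [ha, mul_comm]
      · exact ha'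
      · rw [hc, mul_comm]
      · exact hc'
    · simp only [Matrix.cons_dotProduct, Matrix.dotProduct_of_isEmpty, Matrix.vecHead,
        Matrix.vecTail, Matrix.cons_val_zero, Function.comp, Fin.succ_zero_eq_one,
        Matrix.cons_val_one, add_zero]
      linear_combination htr - ha - hc'

/-- Two nilpotent `2 × 2` matrices over a principal ideal domain whose product has invertible
trace `c` generate a full matrix algebra, and they are simultaneously conjugate to `E₁₂` and
`c E₂₁`. -/
theorem exists_conj_matrix_units [IsDomain R] [IsPrincipalIdealRing R]
    {N M : Matrix (Fin 2) (Fin 2) R} (hN : N.trace = 0) (hN' : N.det = 0) (hM : M.trace = 0)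
    (hM' : M.det = 0) (c : Rˣ) (hc : (N * M).trace = c) :
    ∃ g : GL (Fin 2) R, N * g.val = g.val * !![0, 1; 0, 0] ∧
      M * g.val = g.val * !![0, 0; (c : R), 0] := by
  have hNN := mul_self_eq_zero_of_trace_det hN hN'
  have hMM := mul_self_eq_zero_of_trace_det hM hM'
  set k : R := ((c⁻¹ : Rˣ) : R) with hk
  have hck : (c : R) * k = 1 := by simp [hk]
  obtain ⟨v, w, he, hwv⟩ := exists_vecMulVec_of_idempotent (e := k • (N * M))
    (by rw [Matrix.trace_smul, hc, smul_eq_mul, mul_comm, hck])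
    (by rw [Matrix.det_smul, Matrix.det_mul, hN', zero_mul, mul_zero])
  have hev : (k • (N * M)).mulVec v = v := by
    rw [he, Matrix.vecMulVec_mulVec, hwv]; simp
  have hwe : Matrix.vecMul w (k • (N * M)) = w := by
    rw [he, Matrix.vecMul_vecMulVec, hwv, one_smul]
  have hNv : N.mulVec v = 0 := by
    rw [← hev, Matrix.mulVec_mulVec, Matrix.mul_smul, ← mul_assoc, hNN]; simp
  have hwM : Matrix.vecMul w M = 0 := by
    rw [← hwe, Matrix.vecMul_vecMul, Matrix.smul_mul, mul_assoc, hMM]; simp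
  set v' : Fin 2 → R := k • M.mulVec v with hv'
  have hNv' : N.mulVec v' = v := by
    rw [hv', Matrix.mulVec_smul, Matrix.mulVec_mulVec, ← Matrix.smul_mulVec, hev]
  have hMv : M.mulVec v = (c : R) • v' := by rw [hv', smul_smul, hck, one_smul]
  have hMv' : M.mulVec v' = 0 := by
    rw [hv', Matrix.mulVec_smul, Matrix.mulVec_mulVec, hMM]; simp
  have hwv' : w ⬝ᵥ v' = 0 := by
    rw [hv', dotProduct_smul, Matrix.dotProduct_mulVec, hwM]; simp
  have hw'v : (Matrix.vecMul w N) ⬝ᵥ v = 0 := by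
    rw [← Matrix.dotProduct_mulVec, hNv]; simp
  have hw'v' : (Matrix.vecMul w N) ⬝ᵥ v' = 1 := by
    rw [← Matrix.dotProduct_mulVec, hNv', hwv]
  set g : Matrix (Fin 2) (Fin 2) R := Matrix.of fun i j => ![v i, v' i] j with hg
  set g' : Matrix (Fin 2) (Fin 2) R := Matrix.of fun i j => ![w j, Matrix.vecMul w N j] i with hg'
  have hinv : g' * g = 1 := by
    simp only [dotProduct, Fin.sum_univ_two] at hwv hwv' hw'v hw'v'
    ext i j
    fin_cases i <;> fin_cases j <;> simpa [Matrix.mul_apply, hg, hg']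
  refine ⟨⟨g, g', mul_eq_one_comm.mp hinv, hinv⟩, ?_, ?_⟩
  · ext i j
    have h1 := congrFun hNv i
    have h2 := congrFun hNv' i
    simp only [Matrix.mulVec, dotProduct, Fin.sum_univ_two] at h1 h2
    fin_cases j
    · simpa [Matrix.mul_apply, hg] using h1
    · simpa [Matrix.mul_apply, hg] using h2
  · ext i j
    have h1 := congrFun hMv i
    have h2 := congrFun hMv' i
    simp only [Matrix.mulVec, dotProduct, Fin.sum_univ_two, Pi.smul_apply, smul_eq_mul] at h1 h2
    fin_cases j
    · simpa [Matrix.mul_apply, hg, mul_comm] using h1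
    · simpa [Matrix.mul_apply, hg] using h2

end NilpotentPairs

/-! ### Generation by elementary and diagonal matrices -/

section Generation

variable {R : Type*} [CommRing R]

theorem uGL_eq_mul : uGL R = diagGL R (1, -1) * (upperGL 1 * lowerGL (-1) * upperGL 1) := by
  apply GL_ext <;> simp [mul_val_apply, coe_upperGL, coe_lowerGL, coe_uGL, coe_diagGL]

theorem exists_mul_apply_one_zero_eq_zero {E : Type*} [EuclideanDomain E] (f : E →+* R)
    {H : Subgroup (GL (Fin 2) R)} (hL : ∀ a, lowerGL a ∈ H) (hu : uGL R ∈ H) (a b : E) :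
    ∃ h ∈ H, h.val 1 0 * f a + h.val 1 1 * f b = 0 := by
  induction a, b using EuclideanDomain.GCD.induction with
  | H0 b => exact ⟨uGL R, hu, by simp [coe_uGL]⟩
  | H1 a b ha ih =>
    obtain ⟨h, hh, e⟩ := ih
    refine ⟨h * (uGL R * lowerGL (-f (b / a))), H.mul_mem hh (H.mul_mem hu (hL _)), ?_⟩
    have hmod : f b = f a * f (b / a) + f (b % a) := by
      rw [← map_mul, ← map_add, EuclideanDomain.div_add_mod]
    simp only [mul_val_apply, coe_uGL, coe_lowerGL, Matrix.of_apply, Matrix.cons_val',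
      Matrix.cons_val_zero, Matrix.cons_val_one, Matrix.cons_val_fin_one]
    linear_combination e + h.val 1 0 * hmod

/-- Column reduction: if every pair of elements of `R` is, up to a unit, the image of a pair from a
Euclidean domain, then `GL₂(R)` is generated by elementary and diagonal matrices. -/
theorem eq_top_of_elementary_mem {E : Type*} [EuclideanDomain E] (f : E →+* R)
    (hf : ∀ x y : R, ∃ (r : Rˣ) (a b : E), r * x = f a ∧ r * y = f b)
    {H : Subgroup (GL (Fin 2) R)} (hU : ∀ a, upperGL a ∈ H) (hL : ∀ a, lowerGL a ∈ H)
    (hD : ∀ x, diagGL R x ∈ H) : H = ⊤ := by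
  have hu : uGL R ∈ H := by
    rw [uGL_eq_mul]
    exact H.mul_mem (hD _) (H.mul_mem (H.mul_mem (hU _) (hL _)) (hU _))
  rw [eq_top_iff]
  rintro g -
  obtain ⟨r, a, b, ha, hb⟩ := hf (g.val 0 0) (g.val 1 0)
  obtain ⟨h, hh, e⟩ := exists_mul_apply_one_zero_eq_zero f hL hu a b
  obtain ⟨k, hk⟩ : ∃ k, k = h * g := ⟨_, rfl⟩
  have h10 : k.val 1 0 = 0 := by
    rw [hk, ← r.isUnit.mul_right_eq_zero, mul_val_apply]
    rw [← ha, ← hb] at e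
    linear_combination e
  have hdet : IsUnit (k.val 0 0 * k.val 1 1) := by
    have := (Matrix.GeneralLinearGroup.det k).isUnit
    rwa [det_val, h10, mul_zero, sub_zero] at this
  rw [IsUnit.mul_iff] at hdet
  obtain ⟨⟨α, hα⟩, ⟨β, hβ⟩⟩ := hdet
  have key : k = diagGL R (α, β) * upperGL ((α⁻¹ : Rˣ) * k.val 0 1) := by
    apply GL_ext <;> simp [mul_val_apply, coe_diagGL, coe_upperGL, ← hα, ← hβ, h10]
  rw [← H.mul_mem_cancel_left hh, ← hk, key]
  exact H.mul_mem (hD _) (hU _)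

theorem eq_top_of_elementary_mem_field {F : Type*} [Field F] {H : Subgroup (GL (Fin 2) F)}
    (hU : ∀ a, upperGL a ∈ H) (hL : ∀ a, lowerGL a ∈ H) (hD : ∀ x, diagGL F x ∈ H) : H = ⊤ :=
  eq_top_of_elementary_mem (RingHom.id F) (fun x y => ⟨1, x, y, by simp⟩) hU hL hD

end Generation

/-! ### Traces and Frobenius -/

section TraceOfFiniteOrder

/-- The trace of a `2 × 2` matrix commutes with Frobenius: expand `(M + adj M) ^ pʲ`, where
`M + adj M` is the scalar matrix `tr M`. -/
theorem trace_pow_char_pow {R : Type*} [CommRing R] (p : ℕ) [Fact p.Prime] [CharP R p]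
    (M : Matrix (Fin 2) (Fin 2) R) (j : ℕ) : (M ^ p ^ j).trace = M.trace ^ p ^ j := by
  have hadd : ∀ N : Matrix (Fin 2) (Fin 2) R, N + N.adjugate = Matrix.scalar (Fin 2) N.trace := by
    intro N
    ext i k
    fin_cases i <;> fin_cases k <;>
      simp [Matrix.adjugate_fin_two, Matrix.trace_fin_two, add_comm]
  have hcomm : Commute M M.adjugate := by
    rw [commute_iff_eq, Matrix.mul_adjugate, Matrix.adjugate_mul]
  have h := hadd (M ^ p ^ j)
  rw [Matrix.adjugate_pow, ← add_pow_char_pow_of_commute p j hcomm, hadd, ← map_pow] at h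
  have := congrFun (congrFun h 0) 0
  simpa using this.symm

end TraceOfFiniteOrder

/-! ### Matrices over Laurent polynomials -/

section Laurent

variable {F : Type*} [Field F]

open LaurentPolynomial in
theorem C_injective : Function.Injective (C : F →+* F[T;T⁻¹]) := (C : F →+* F[T;T⁻¹]).injective

instance : IsPrincipalIdealRing F[T;T⁻¹] where
  principal I := by
    obtain ⟨p, hp⟩ := IsPrincipalIdealRing.principal (I.comap (algebraMap (Polynomial F) F[T;T⁻¹]))
    refine ⟨algebraMap (Polynomial F) F[T;T⁻¹] p, ?_⟩
    have h := IsLocalization.map_under (Submonoid.powers (Polynomial.X : Polynomial F)) F[T;T⁻¹] I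
    change Ideal.map _ (I.comap (algebraMap (Polynomial F) F[T;T⁻¹])) = I at h
    rw [← h, hp]
    exact (Ideal.map_span _ _).trans (by rw [Set.image_singleton])

open LaurentPolynomial in
theorem coe_tUnit_zpow (m : ℤ) : ((tUnit F ^ m : (F[T;T⁻¹])ˣ) : F[T;T⁻¹]) = T m := by
  have hnat : ∀ k : ℕ, ((tUnit F ^ k : (F[T;T⁻¹])ˣ) : F[T;T⁻¹]) = T k := by
    intro k
    rw [Units.val_pow_eq_pow_val]
    change (T 1 : F[T;T⁻¹]) ^ k = T k
    rw [T_pow, mul_one]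
  obtain ⟨k, rfl | rfl⟩ := m.eq_nat_or_neg
  · rw [zpow_natCast, hnat]
  · rw [zpow_neg, zpow_natCast]
    refine Units.inv_eq_of_mul_eq_one_right ?_
    rw [hnat, ← T_add, add_neg_cancel, T_zero]

/-- The inclusion of the units of `F` into the units of `F[t,t⁻¹]`. -/
noncomputable def constUnit (F : Type*) [Field F] : Fˣ →* (F[T;T⁻¹])ˣ :=
  Units.map (LaurentPolynomial.C : F →+* F[T;T⁻¹]).toMonoidHom

theorem coe_constUnit (a : Fˣ) :
    ((constUnit F a : (F[T;T⁻¹])ˣ) : F[T;T⁻¹]) = LaurentPolynomial.C (a : F) := rfl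

/-- The units of `F[t,t⁻¹]` are the monomials. -/
theorem exists_eq_constUnit_mul_zpow (α : (F[T;T⁻¹])ˣ) :
    ∃ (a : Fˣ) (m : ℤ), α = constUnit F a * tUnit F ^ m := by
  obtain ⟨n, f, hf⟩ := LaurentPolynomial.exists_T_pow (α : F[T;T⁻¹])
  obtain ⟨k, g, hg⟩ := LaurentPolynomial.exists_T_pow ((α⁻¹ : (F[T;T⁻¹])ˣ) : F[T;T⁻¹])
  have hfg : f * g = Polynomial.X ^ (n + k) := by
    apply Polynomial.toLaurent_injective
    rw [map_mul, hf, hg, Polynomial.toLaurent_X_pow, mul_mul_mul_comm, Units.mul_inv, one_mul,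
      ← LaurentPolynomial.T_add, Nat.cast_add]
  obtain ⟨i, -, v, hv⟩ :=
    (dvd_prime_pow Polynomial.prime_X _).mp (Dvd.intro _ hfg)
  obtain ⟨a, ha, hav⟩ := Polynomial.isUnit_iff.mp (v⁻¹).isUnit
  have hfX : f = Polynomial.X ^ i * Polynomial.C a := by
    rw [hav, ← hv, Units.mul_inv_cancel_right]
  refine ⟨ha.unit, i - n, Units.ext ?_⟩
  rw [Units.val_mul, coe_constUnit, coe_tUnit_zpow, IsUnit.unit_spec, LaurentPolynomial.T_sub,
    ← mul_assoc, mul_comm (LaurentPolynomial.C a), ← Polynomial.toLaurent_X_pow,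
    ← Polynomial.toLaurent_C, ← map_mul, ← hfX, hf, mul_assoc, ← LaurentPolynomial.T_add,
    add_neg_cancel, LaurentPolynomial.T_zero, mul_one]

theorem constUnit_mul_zpow_inj {a b : Fˣ} {m n : ℤ}
    (h : constUnit F a * tUnit F ^ m = constUnit F b * tUnit F ^ n) : a = b ∧ m = n := by
  have h' := congrArg (fun x : (F[T;T⁻¹])ˣ => (x : F[T;T⁻¹])) h
  simp only [Units.val_mul, coe_constUnit, coe_tUnit_zpow] at h'
  have hd := congrArg LaurentPolynomial.degree h'
  rw [LaurentPolynomial.degree_C_mul_T _ _ a.ne_zero,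
    LaurentPolynomial.degree_C_mul_T _ _ b.ne_zero] at hd
  have hmn : m = n := by exact_mod_cast hd
  subst hmn
  refine ⟨Units.ext (C_injective ?_), rfl⟩
  have := congrArg (fun x : (F[T;T⁻¹])ˣ => (x : F[T;T⁻¹])) (mul_right_cancel h)
  simpa [coe_constUnit] using this

/-- A matrix of finite order in `GL₂(F[t,t⁻¹])`, in positive characteristic, has constant trace:
the Frobenius orbit of its trace is finite. -/
theorem exists_trace_eq_C_of_isOfFinOrder (p : ℕ) [Fact p.Prime] [CharP F p]
    {g : GL (Fin 2) F[T;T⁻¹]} (hg : IsOfFinOrder g) :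
    ∃ a : F, g.val.trace = LaurentPolynomial.C a := by
  have : CharP F[T;T⁻¹] p := charP_of_injective_ringHom (C_injective (F := F)) p
  have : Finite (Subgroup.zpowers g) := hg.finite_zpowers
  obtain ⟨i, j, hij, h⟩ : ∃ i j : ℕ, i < j ∧ g ^ p ^ i = g ^ p ^ j := by
    obtain ⟨i, j, hij, h⟩ := Finite.exists_ne_map_eq_of_infinite
      (fun i : ℕ => (⟨g ^ p ^ i, Subgroup.npow_mem_zpowers g _⟩ : Subgroup.zpowers g))
    have h' := congrArg Subtype.val h
    rcases lt_or_gt_of_ne hij with hlt | hlt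
    · exact ⟨i, j, hlt, h'⟩
    · exact ⟨j, i, hlt, h'.symm⟩
  have ht : g.val.trace ^ p ^ i = g.val.trace ^ p ^ j := by
    rw [← trace_pow_char_pow, ← trace_pow_char_pow, ← Units.val_pow_eq_pow_val, h,
      Units.val_pow_eq_pow_val]
  by_cases h0 : g.val.trace = 0
  · exact ⟨0, by rw [h0, map_zero]⟩
  have hlt : p ^ i < p ^ j := Nat.pow_lt_pow_right (Fact.out : p.Prime).one_lt hij
  obtain ⟨k, hk⟩ := Nat.exists_eq_add_of_lt hlt
  have h1 : g.val.trace ^ (k + 1) = 1 := by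
    apply mul_left_cancel₀ (pow_ne_zero (p ^ i) h0)
    rw [← pow_add, mul_one, ht, hk, add_assoc]
  obtain ⟨τ, hτ⟩ := IsUnit.of_pow_eq_one h1 (Nat.succ_ne_zero k)
  obtain ⟨a, m, rfl⟩ := exists_eq_constUnit_mul_zpow τ
  have h2 : constUnit F (a ^ (k + 1)) * tUnit F ^ (m * (k + 1 : ℕ)) =
      constUnit F 1 * tUnit F ^ (0 : ℤ) := by
    rw [map_pow, zpow_mul, zpow_natCast, ← mul_pow]
    apply Units.ext
    rw [Units.val_pow_eq_pow_val, hτ, h1]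
    simp
  have hm : m = 0 := by
    have := (constUnit_mul_zpow_inj h2).2
    rcases mul_eq_zero.mp this with h | h
    · exact h
    · exact absurd h (by positivity)
  refine ⟨a, ?_⟩
  rw [← hτ, hm, zpow_zero, mul_one, coe_constUnit]

theorem constGL_val (g : GL (Fin 2) F) (i j : Fin 2) :
    (constGL F g).val i j = LaurentPolynomial.C (g.val i j) := rfl

theorem constGL_injective : Function.Injective (constGL F) := by
  intro g h e
  apply GL_ext <;> exact C_injective (congrArg (fun g : GL (Fin 2) F[T;T⁻¹] => g.val _ _) e)

theorem constGL_upperGL (a : F) :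
    constGL F (upperGL a) = upperGL (LaurentPolynomial.C a) := by
  apply GL_ext <;> simp [constGL_val, coe_upperGL]

theorem constGL_lowerGL (a : F) :
    constGL F (lowerGL a) = lowerGL (LaurentPolynomial.C a) := by
  apply GL_ext <;> simp [constGL_val, coe_lowerGL]

theorem constGL_uGL : constGL F (uGL F) = uGL F[T;T⁻¹] := by
  apply GL_ext <;> simp [constGL_val, coe_uGL]

theorem constGL_diagGL (a b : Fˣ) :
    constGL F (diagGL F (a, b)) = diagGL F[T;T⁻¹] (constUnit F a, constUnit F b) := by
  apply GL_ext <;> simp [constGL_val, coe_diagGL, coe_constUnit]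

theorem constGL_mem_torus_iff (g : GL (Fin 2) F) :
    constGL F g ∈ torus F[T;T⁻¹] ↔ g ∈ torus F := by
  rw [mem_torus_iff, mem_torus_iff, constGL_val, constGL_val]
  simp only [map_eq_zero_iff _ C_injective]

/-- `GL₂(F[t,t⁻¹])` is generated by the constant matrices and `δ(t,1)`. -/
theorem eq_top_of_constGL_mem {H : Subgroup (GL (Fin 2) F[T;T⁻¹])}
    (hC : ∀ g, constGL F g ∈ H) (hD : diagGL F[T;T⁻¹] (tUnit F, 1) ∈ H) : H = ⊤ := by
  have hu : uGL F[T;T⁻¹] ∈ H := constGL_uGL (F := F) ▸ hC _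
  have hpow : ∀ m n : ℤ, diagGL F[T;T⁻¹] (tUnit F ^ m, tUnit F ^ n) ∈ H := by
    intro m n
    have h1 : diagGL F[T;T⁻¹] (tUnit F ^ m, tUnit F ^ n) = diagGL F[T;T⁻¹] (tUnit F, 1) ^ m *
        (uGL F[T;T⁻¹] * diagGL F[T;T⁻¹] (tUnit F, 1) * (uGL F[T;T⁻¹])⁻¹) ^ n := by
      rw [uGL_conj_diagGL, ← map_zpow, ← map_zpow, ← map_mul]
      simp
    rw [h1]
    exact H.mul_mem (H.zpow_mem hD _)
      (H.zpow_mem (H.mul_mem (H.mul_mem hu hD) (H.inv_mem hu)) _)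
  have hU : ∀ a, upperGL a ∈ H := by
    intro a
    induction a using LaurentPolynomial.induction_on' with
    | add p q hp hq => rw [← upperGL_mul]; exact H.mul_mem hp hq
    | C_mul_T n a =>
      have h1 := diagGL_mul_upperGL (tUnit F ^ n) (tUnit F ^ (0 : ℤ)) (LaurentPolynomial.C a)
      rw [coe_tUnit_zpow, zpow_zero, inv_one, Units.val_one, mul_one,
        mul_comm (LaurentPolynomial.T n), ← constGL_upperGL, ← zpow_zero (tUnit F), eq_comm,
        ← eq_mul_inv_iff_mul_eq] at h1
      rw [h1]
      exact H.mul_mem (H.mul_mem (hpow _ _) (hC _)) (H.inv_mem (hpow _ _))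
  have hL : ∀ a, lowerGL a ∈ H := by
    intro a
    have : lowerGL a = uGL F[T;T⁻¹] * upperGL a * uGL F[T;T⁻¹] := by
      apply GL_ext <;> simp [mul_val_apply, coe_upperGL, coe_lowerGL, coe_uGL]
    rw [this]
    exact H.mul_mem (H.mul_mem hu (hU _)) hu
  refine eq_top_of_elementary_mem (Polynomial.toLaurent : Polynomial F →+* F[T;T⁻¹]) ?_ hU hL ?_
  · intro x y
    obtain ⟨n, f, hf⟩ := LaurentPolynomial.exists_T_pow x
    obtain ⟨k, g, hg⟩ := LaurentPolynomial.exists_T_pow y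
    refine ⟨tUnit F ^ (n + k : ℤ), f * Polynomial.X ^ k, g * Polynomial.X ^ n, ?_, ?_⟩
    · rw [coe_tUnit_zpow, map_mul, hf, Polynomial.toLaurent_X_pow, mul_assoc,
        ← LaurentPolynomial.T_add, mul_comm]
    · rw [coe_tUnit_zpow, map_mul, hg, Polynomial.toLaurent_X_pow, mul_assoc,
        ← LaurentPolynomial.T_add, mul_comm, add_comm (n : ℤ)]
  · rintro ⟨α, β⟩
    obtain ⟨a, m, rfl⟩ := exists_eq_constUnit_mul_zpow α
    obtain ⟨b, n, rfl⟩ := exists_eq_constUnit_mul_zpow β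
    have h1 := map_mul (diagGL F[T;T⁻¹]) (constUnit F a, constUnit F b)
      (tUnit F ^ m, tUnit F ^ n)
    rw [← constGL_diagGL] at h1
    exact h1 ▸ H.mul_mem (hC _) (hpow _ _)

end Laurent

/-! ### Outer classes -/

section OuterClasses

variable {G : Type*} [Group G]

theorem mulAut_mul_conj (φ : MulAut G) (g : G) : φ * MulAut.conj g = MulAut.conj (φ g) * φ := by
  ext x
  simp [MulAut.conj_apply]

theorem outClass_eq_iff (φ ψ : MulAut G) :
    outClass G φ = outClass G ψ ↔ ∃ g, φ = MulAut.conj g * ψ := by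
  rw [eq_comm, QuotientGroup.mk'_eq_mk']
  constructor
  · rintro ⟨_, ⟨g, rfl⟩, h⟩
    exact ⟨ψ g, by rw [← h, mulAut_mul_conj]⟩
  · rintro ⟨g, rfl⟩
    refine ⟨MulAut.conj (ψ⁻¹ g), ⟨_, rfl⟩, ?_⟩
    rw [mulAut_mul_conj]
    simp

theorem outClass_conj (g : G) : outClass G (MulAut.conj g) = 1 :=
  (QuotientGroup.eq_one_iff _).mpr ⟨g, rfl⟩

end OuterClasses

/-! ### Embeddings of `GL₂(F)` -/

section Rigidity

variable {F : Type*} [Field F] {R : Type*} [CommRing R]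

theorem upperGL_pow_char (p : ℕ) [CharP R p] (a : R) : upperGL a ^ p = 1 := by
  rw [upperGL_pow, CharP.cast_eq_zero, zero_mul, upperGL_zero]

theorem lowerGL_pow_char (p : ℕ) [CharP R p] (a : R) : lowerGL a ^ p = 1 := by
  rw [lowerGL_pow, CharP.cast_eq_zero, zero_mul, lowerGL_zero]

theorem trace_det_sub_one_of_pow_char_eq_one [IsDomain R] (p : ℕ) [Fact p.Prime] [CharP R p]
    {g : GL (Fin 2) R} (hg : g ^ p = 1) : (g.val - 1).trace = 0 ∧ (g.val - 1).det = 0 := by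
  apply trace_det_eq_zero_of_isNilpotent
  refine ⟨p, ?_⟩
  rw [sub_pow_char_of_commute p (Commute.one_right _), ← Units.val_pow_eq_pow_val, hg]
  simp

theorem upperGL_not_commute_lowerGL [Nontrivial R] :
    upperGL (1 : R) * lowerGL 1 ≠ lowerGL 1 * upperGL 1 := by
  intro h
  simpa [mul_val_apply, coe_upperGL, coe_lowerGL] using
    congrArg (fun g : GL (Fin 2) R => g.val 0 0) h

/-- An embedding of `GL₂(F)` into `GL₂(R)`, with `R` a principal ideal domain of the same positive
characteristic, can be conjugated so that it takes the elementary unipotent matrices to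
elementary unipotent matrices. The images of the two unipotents differ from `1` by nilpotent
matrices that do not commute, so the product of these has nonzero trace. -/
theorem exists_conj_unipotents [IsDomain R] [IsPrincipalIdealRing R] (p : ℕ) [Fact p.Prime]
    [CharP F p] [CharP R p] {φ : GL (Fin 2) F →* GL (Fin 2) R} (hφ : Function.Injective φ)
    (hunit : (((φ (upperGL 1)).val - 1) * ((φ (lowerGL 1)).val - 1)).trace ≠ 0 →
      IsUnit (((φ (upperGL 1)).val - 1) * ((φ (lowerGL 1)).val - 1)).trace) :
    ∃ (g : GL (Fin 2) R) (c : Rˣ), MulAut.conj g (φ (upperGL 1)) = upperGL 1 ∧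
      MulAut.conj g (φ (lowerGL 1)) = lowerGL (c : R) := by
  obtain ⟨hN, hN'⟩ := trace_det_sub_one_of_pow_char_eq_one (R := R) p (g := φ (upperGL 1))
    (by rw [← map_pow, upperGL_pow_char, map_one])
  obtain ⟨hM, hM'⟩ := trace_det_sub_one_of_pow_char_eq_one (R := R) p (g := φ (lowerGL 1))
    (by rw [← map_pow, lowerGL_pow_char, map_one])
  have hne : (((φ (upperGL 1)).val - 1) * ((φ (lowerGL 1)).val - 1)).trace ≠ 0 := by
    intro h
    have h' := commute_of_trace_mul_eq_zero hN hN' hM hM' h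
    apply upperGL_not_commute_lowerGL (R := F)
    apply hφ
    rw [map_mul, map_mul]
    apply Units.ext
    rw [Units.val_mul, Units.val_mul]
    have e := sub_eq_zero.mpr h'
    rw [← sub_eq_zero, ← e]
    noncomm_ring
  obtain ⟨c, hc⟩ := hunit hne
  obtain ⟨g, h1, h2⟩ := exists_conj_matrix_units hN hN' hM hM' c hc.symm
  have e1 : (!![1, 1; 0, 1] : Matrix (Fin 2) (Fin 2) R) = 1 + !![0, 1; 0, 0] := by
    ext i j; fin_cases i <;> fin_cases j <;> simp
  have e2 : (!![1, 0; (c : R), 1] : Matrix (Fin 2) (Fin 2) R) = 1 + !![0, 0; (c : R), 0] := by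
    ext i j; fin_cases i <;> fin_cases j <;> simp
  refine ⟨g⁻¹, c, ?_, ?_⟩
  · rw [MulAut.conj_apply, inv_inv, mul_assoc, inv_mul_eq_iff_eq_mul]
    apply Units.ext
    rw [Units.val_mul, Units.val_mul, coe_upperGL, e1, mul_add, ← h1]
    noncomm_ring
  · rw [MulAut.conj_apply, inv_inv, mul_assoc, inv_mul_eq_iff_eq_mul]
    apply Units.ext
    rw [Units.val_mul, Units.val_mul, coe_lowerGL, e2, mul_add, ← h2]
    noncomm_ring

/-- An inner automorphism that fixes the two elementary unipotent matrices is trivial. -/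
theorem conj_eq_one_of_fix_unipotents {g : GL (Fin 2) R}
    (h1 : MulAut.conj g (upperGL 1) = upperGL 1) (h2 : MulAut.conj g (lowerGL 1) = lowerGL 1) :
    MulAut.conj g = 1 := by
  rw [MulAut.conj_apply, mul_inv_eq_iff_eq_mul] at h1 h2
  obtain ⟨a, rfl⟩ := mem_center_of_commute_unipotents isUnit_one h1 h2
  ext x : 1
  rw [MulAut.conj_apply, commute_scalar, mul_inv_cancel_right, MulAut.one_apply]

end Rigidity

/-! ### Automorphisms that stabilise the constant matrices -/

section ConstantMatrices

variable {F : Type*} [Field F]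

theorem constGL_mem_range_iff (g : GL (Fin 2) F[T;T⁻¹]) :
    g ∈ (constGL F).range ↔ ∀ i j, ∃ a : F, g.val i j = LaurentPolynomial.C a := by
  constructor
  · rintro ⟨k, rfl⟩ i j
    exact ⟨k.val i j, rfl⟩
  · intro h
    choose m hm using h
    have hdet : (Matrix.of m).det ≠ 0 := by
      intro h0
      apply (Matrix.GeneralLinearGroup.det g).ne_zero
      rw [det_val, hm, hm, hm, hm, ← map_mul, ← map_mul, ← map_sub]
      rw [Matrix.det_fin_two] at h0
      exact (congrArg _ h0).trans (map_zero _)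
    refine ⟨Matrix.GeneralLinearGroup.mkOfDetNeZero (Matrix.of m) hdet, ?_⟩
    ext i j : 2
    exact (hm i j).symm

/-- The entries of the matrices in the image of `ψ` are combinations of traces of matrices of
finite order, which are constant. -/
theorem range_le_constGL_range [Finite F] {ψ : GL (Fin 2) F →* GL (Fin 2) F[T;T⁻¹]}
    {c : (F[T;T⁻¹])ˣ} (h1 : ψ (upperGL 1) = upperGL 1) (h2 : ψ (lowerGL 1) = lowerGL (c : F[T;T⁻¹]))
    (k : GL (Fin 2) F) : ψ k ∈ (constGL F).range := by
  obtain ⟨p, hp⟩ := CharP.exists F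
  have : Fact p.Prime := ⟨CharP.char_is_prime F p⟩
  have htr : ∀ k, ∃ a : F, (ψ k).val.trace = LaurentPolynomial.C a := fun k =>
    exists_trace_eq_C_of_isOfFinOrder p (MonoidHom.isOfFinOrder ψ (isOfFinOrder_of_finite k))
  obtain ⟨d, hd⟩ : ∃ d : F, (c : F[T;T⁻¹]) = LaurentPolynomial.C d := by
    obtain ⟨a, ha⟩ := htr (upperGL 1 * lowerGL 1)
    refine ⟨a - 2, ?_⟩
    rw [map_mul, h1, h2, Matrix.trace_fin_two, mul_val_apply, mul_val_apply] at ha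
    simp only [coe_upperGL, coe_lowerGL, Matrix.of_apply, Matrix.cons_val',
      Matrix.cons_val_zero, Matrix.cons_val_one, Matrix.cons_val_fin_one] at ha
    rw [map_sub, ← ha, map_ofNat]
    ring
  have hd0 : d ≠ 0 := by
    rintro rfl
    exact c.ne_zero (hd.trans (map_zero _))
  have hdd : LaurentPolynomial.C d * LaurentPolynomial.C d⁻¹ = (1 : F[T;T⁻¹]) := by
    rw [← map_mul, mul_inv_cancel₀ hd0, map_one]
  obtain ⟨a0, e0⟩ := htr k
  obtain ⟨a1, e1⟩ := htr (k * upperGL 1)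
  obtain ⟨a2, e2⟩ := htr (k * lowerGL 1)
  obtain ⟨a3, e3⟩ := htr (k * upperGL 1 * lowerGL 1)
  simp only [map_mul, h1, h2, hd, Matrix.trace_fin_two, mul_val_apply, coe_upperGL, coe_lowerGL,
    Matrix.of_apply, Matrix.cons_val', Matrix.cons_val_zero, Matrix.cons_val_one,
    Matrix.cons_val_fin_one] at e0 e1 e2 e3
  have h10 : (ψ k).val 1 0 = LaurentPolynomial.C (a1 - a0) := by
    rw [map_sub]
    linear_combination e1 - e0
  have h01 : (ψ k).val 0 1 = LaurentPolynomial.C (d⁻¹ * (a2 - a0)) := by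
    rw [map_mul, map_sub]
    linear_combination LaurentPolynomial.C d⁻¹ * (e2 - e0) - (ψ k).val 0 1 * hdd
  have h00 : (ψ k).val 0 0 = LaurentPolynomial.C (d⁻¹ * (a3 - a2 - a1 + a0)) := by
    rw [map_mul, map_add, map_sub, map_sub]
    linear_combination LaurentPolynomial.C d⁻¹ * (e3 - e2 - e1 + e0) - (ψ k).val 0 0 * hdd
  have h11 : (ψ k).val 1 1 = LaurentPolynomial.C (a0 - d⁻¹ * (a3 - a2 - a1 + a0)) := by
    rw [map_sub, ← h00]
    linear_combination e0
  rw [constGL_mem_range_iff]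
  intro i j
  fin_cases i <;> fin_cases j
  exacts [⟨_, h00⟩, ⟨_, h01⟩, ⟨_, h10⟩, ⟨_, h11⟩]

/-- Every embedding of `GL₂(F)` into `GL₂(F[t,t⁻¹])` is conjugate to one with constant values. -/
theorem exists_conj_range_le_constGL_range [Finite F]
    {φ : GL (Fin 2) F →* GL (Fin 2) F[T;T⁻¹]} (hφ : Function.Injective φ) :
    ∃ g, ∀ k, MulAut.conj g (φ k) ∈ (constGL F).range := by
  obtain ⟨p, hp⟩ := CharP.exists F
  have : Fact p.Prime := ⟨CharP.char_is_prime F p⟩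
  have : CharP F[T;T⁻¹] p := charP_of_injective_ringHom (C_injective (F := F)) p
  have htr : ∀ k, ∃ a : F, (φ k).val.trace = LaurentPolynomial.C a := fun k =>
    exists_trace_eq_C_of_isOfFinOrder p (MonoidHom.isOfFinOrder φ (isOfFinOrder_of_finite k))
  obtain ⟨g, c, h1, h2⟩ := exists_conj_unipotents p hφ (by
    obtain ⟨a1, e1⟩ := htr (upperGL 1)
    obtain ⟨a2, e2⟩ := htr (lowerGL 1)
    obtain ⟨a3, e3⟩ := htr (upperGL 1 * lowerGL 1)
    have e : (((φ (upperGL 1)).val - 1) * ((φ (lowerGL 1)).val - 1)).trace =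
        LaurentPolynomial.C (a3 - a1 - a2 + 2) := by
      rw [map_add, map_sub, map_sub, ← e1, ← e2, ← e3, map_mul, Units.val_mul, map_ofNat,
        sub_mul, mul_sub, one_mul, mul_one, Matrix.trace_sub, Matrix.trace_sub, Matrix.trace_sub,
        Matrix.trace_one, Fintype.card_fin]
      push_cast
      ring
    rw [e]
    intro h
    exact (isUnit_iff_ne_zero.mpr fun h0 => h (by rw [h0, map_zero])).map LaurentPolynomial.C)
  exact ⟨g, range_le_constGL_range (ψ := (MulAut.conj g).toMonoidHom.comp φ) h1 h2⟩

theorem exists_mulAut_restrict [Finite F] (φ : MulAut (GL (Fin 2) F[T;T⁻¹]))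
    (h : ∀ k, φ (constGL F k) ∈ (constGL F).range) :
    ∃ f : MulAut (GL (Fin 2) F), ∀ k, φ (constGL F k) = constGL F (f k) := by
  choose f hf using h
  have hinj : Function.Injective f := by
    intro a b hab
    apply constGL_injective
    apply φ.injective
    rw [← hf, ← hf, hab]
  let f' : GL (Fin 2) F →* GL (Fin 2) F := MonoidHom.mk' f (fun a b => constGL_injective
    (by rw [map_mul, hf, hf, hf, map_mul, map_mul]))
  exact ⟨MulEquiv.ofBijective f' (Finite.injective_iff_bijective.mp hinj), fun k => (hf k).symm⟩

/-- The automorphisms of `GL₂(F[t,t⁻¹])` that stabilise the group of constant matrices and restrict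
to a member of `W` on it. -/
def constRestrict (W : Subgroup (MulAut (GL (Fin 2) F))) :
    Subgroup (MulAut (GL (Fin 2) F[T;T⁻¹])) where
  carrier := {φ | ∃ w ∈ W, ∀ g, φ (constGL F g) = constGL F (w g)}
  one_mem' := ⟨1, W.one_mem, fun _ => rfl⟩
  mul_mem' := by
    rintro φ ψ ⟨v, hv, hφ⟩ ⟨w, hw, hψ⟩
    exact ⟨v * w, W.mul_mem hv hw, fun g => by rw [MulAut.mul_apply, hψ, hφ, MulAut.mul_apply]⟩
  inv_mem' := by
    rintro φ ⟨w, hw, hφ⟩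
    refine ⟨w⁻¹, W.inv_mem hw, fun g => ?_⟩
    apply φ.injective
    rw [hφ, MulAut.apply_inv_self, MulAut.apply_inv_self]

variable {W : Subgroup (MulAut (GL (Fin 2) F))}

theorem exists_mem_constRestrict [Finite F] (hW : RepresentsOut F W)
    (φ : MulAut (GL (Fin 2) F[T;T⁻¹])) :
    ∃ φ' ∈ constRestrict W, outClass (GL (Fin 2) F[T;T⁻¹]) φ' = outClass _ φ := by
  obtain ⟨g, hg⟩ := exists_conj_range_le_constGL_range (φ := φ.toMonoidHom.comp (constGL F))
    (φ.injective.comp constGL_injective)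
  obtain ⟨f, hf⟩ := exists_mulAut_restrict (MulAut.conj g * φ) hg
  obtain ⟨w, hw⟩ := hW.bijective.2 (outClass _ f)
  obtain ⟨k, hk⟩ := (outClass_eq_iff _ _).mp hw
  refine ⟨MulAut.conj (constGL F k) * (MulAut.conj g * φ), ⟨w, w.2, fun x => ?_⟩, ?_⟩
  · change w.1 = _ at hk
    rw [MulAut.mul_apply, hf, hk, MulAut.mul_apply, MulAut.conj_apply, MulAut.conj_apply,
      map_mul, map_mul, map_inv]
  · rw [map_mul, map_mul, outClass_conj, outClass_conj, one_mul, one_mul]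

/-- The specialisation `t ↦ 1` is a retraction of the inclusion of the constant matrices. -/
theorem exists_retraction_constGL :
    ∃ r : GL (Fin 2) F[T;T⁻¹] →* GL (Fin 2) F, ∀ g, r (constGL F g) = g := by
  refine ⟨Matrix.GeneralLinearGroup.map (LaurentPolynomial.eval₂ (RingHom.id F) 1), fun g => ?_⟩
  ext i j
  exact LaurentPolynomial.eval₂_C (RingHom.id F) 1 (g.val i j)

theorem conj_eq_one_of_commute_constGL {g : GL (Fin 2) F[T;T⁻¹]}
    (h : ∀ k, MulAut.conj g (constGL F k) = constGL F k) : MulAut.conj g = 1 := by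
  have h1 := h (upperGL 1)
  have h2 := h (lowerGL 1)
  rw [constGL_upperGL, map_one] at h1
  rw [constGL_lowerGL, map_one] at h2
  exact conj_eq_one_of_fix_unipotents h1 h2

/-- An outer class of `GL₂(F[t,t⁻¹])` has at most one representative that restricts to a member of
`W` on the constant matrices: an inner automorphism of `GL₂(F[t,t⁻¹])` that stabilises them
restricts to an inner automorphism of `GL₂(F)`, as the specialisation `t ↦ 1` of the conjugating
matrix shows. -/
theorem eq_of_mem_constRestrict (hW : RepresentsOut F W) {φ ψ : MulAut (GL (Fin 2) F[T;T⁻¹])}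
    (hφ : φ ∈ constRestrict W) (hψ : ψ ∈ constRestrict W)
    (h : outClass (GL (Fin 2) F[T;T⁻¹]) φ = outClass _ ψ) : φ = ψ := by
  obtain ⟨g, hg⟩ := (outClass_eq_iff _ _).mp h
  obtain ⟨w, hw, e⟩ : MulAut.conj g ∈ constRestrict W := by
    rw [eq_mul_inv_of_mul_eq hg.symm]
    exact (constRestrict W).mul_mem hφ ((constRestrict W).inv_mem hψ)
  obtain ⟨r, hr⟩ := exists_retraction_constGL (F := F)
  have hw' : w = MulAut.conj (r g) := by
    ext x : 1
    rw [← hr (w x), ← e, MulAut.conj_apply, map_mul, map_mul, map_inv, hr, MulAut.conj_apply]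
  have hw1 : (⟨w, hw⟩ : W) = 1 := by
    apply hW.bijective.1
    rw [map_one]
    change outClass _ w = 1
    rw [hw', outClass_conj]
  have hw1' : w = 1 := congrArg Subtype.val hw1
  subst hw1'
  rw [hg, conj_eq_one_of_commute_constGL (fun k => e k), one_mul]

end ConstantMatrices

/-! ### Determinant twists and field automorphisms -/

section Twist

variable {F : Type*} [Field F]

/-- The endomorphism `g ↦ χ(det g) g` of `GL₂(F)`, for a homomorphism `χ : Fˣ → Fˣ`. -/
def detTwist (χ : Fˣ →* Fˣ) : GL (Fin 2) F →* GL (Fin 2) F where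
  toFun g := diagGL F (χ (Matrix.GeneralLinearGroup.det g), χ (Matrix.GeneralLinearGroup.det g)) * g
  map_one' := by
    rw [map_one, map_one, mul_one]
    exact map_one (diagGL F)
  map_mul' g h := by
    have e : diagGL F (χ (Matrix.GeneralLinearGroup.det (g * h)),
        χ (Matrix.GeneralLinearGroup.det (g * h))) =
        diagGL F (χ (Matrix.GeneralLinearGroup.det g), χ (Matrix.GeneralLinearGroup.det g)) *
        diagGL F (χ (Matrix.GeneralLinearGroup.det h), χ (Matrix.GeneralLinearGroup.det h)) := by
      rw [← map_mul, map_mul, map_mul]; rfl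
    rw [e, mul_assoc, ← mul_assoc _ g h, commute_scalar _ g, mul_assoc, mul_assoc]

theorem detTwist_apply (χ : Fˣ →* Fˣ) (g : GL (Fin 2) F) :
    detTwist χ g =
      diagGL F (χ (Matrix.GeneralLinearGroup.det g), χ (Matrix.GeneralLinearGroup.det g)) * g := rfl

theorem det_diagGL {R : Type*} [CommRing R] (a b : Rˣ) :
    Matrix.GeneralLinearGroup.det (diagGL R (a, b)) = a * b :=
  Units.ext (by simp [coe_diagGL])

theorem det_upperGL {R : Type*} [CommRing R] (a : R) :
    Matrix.GeneralLinearGroup.det (upperGL a) = 1 :=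
  Units.ext (by simp [coe_upperGL])

theorem det_lowerGL {R : Type*} [CommRing R] (a : R) :
    Matrix.GeneralLinearGroup.det (lowerGL a) = 1 :=
  Units.ext (by simp [coe_lowerGL])

theorem detTwist_of_det_eq_one (χ : Fˣ →* Fˣ) {g : GL (Fin 2) F}
    (hg : Matrix.GeneralLinearGroup.det g = 1) : detTwist χ g = g := by
  rw [detTwist_apply, hg, map_one]
  exact (congrArg (· * g) (map_one (diagGL F))).trans (one_mul g)

theorem detTwist_diagGL (χ : Fˣ →* Fˣ) (a b : Fˣ) :
    detTwist χ (diagGL F (a, b)) = diagGL F (χ (a * b) * a, χ (a * b) * b) := by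
  rw [detTwist_apply, det_diagGL, ← map_mul]
  rfl

theorem entryAut_val (ρ : F ≃+* F) (g : GL (Fin 2) F) (i j : Fin 2) :
    (entryAut ρ g).val i j = ρ (g.val i j) := rfl

theorem entryAut_upperGL (ρ : F ≃+* F) (a : F) : entryAut ρ (upperGL a) = upperGL (ρ a) := by
  apply GL_ext <;> simp [entryAut_val, coe_upperGL]

theorem entryAut_lowerGL (ρ : F ≃+* F) (a : F) : entryAut ρ (lowerGL a) = lowerGL (ρ a) := by
  apply GL_ext <;> simp [entryAut_val, coe_lowerGL]

end Twist

/-! ### The automorphisms of `GL₂(F)` -/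

section Classification

variable {F : Type*} [Field F]

/-- The matrix with rows `(0, 1)` and `(-1, 0)`, which has determinant one. -/
def sGL (F : Type*) [Field F] : GL (Fin 2) F := upperGL 1 * lowerGL (-1) * upperGL 1

theorem coe_sGL : (sGL F : Matrix (Fin 2) (Fin 2) F) = !![0, 1; -1, 0] := by
  ext i j
  fin_cases i <;> fin_cases j <;>
    simp [sGL, Matrix.mul_apply, coe_upperGL, coe_lowerGL]

theorem det_sGL : Matrix.GeneralLinearGroup.det (sGL F) = 1 :=
  Units.ext (by simp [coe_sGL])

theorem sGL_conj_diagGL (a b : Fˣ) : sGL F * diagGL F (a, b) * (sGL F)⁻¹ = diagGL F (b, a) :=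
  antidiagonal_conj (by simp [coe_sGL]) (by simp [coe_sGL]) a b

theorem diagGL_conj_upperGL (a b : Fˣ) (r : F) :
    diagGL F (a, b) * upperGL r * (diagGL F (a, b))⁻¹ = upperGL (a * r * (b⁻¹ : Fˣ)) := by
  rw [diagGL_mul_upperGL, mul_inv_cancel_right]

theorem diagGL_conj_lowerGL (a b : Fˣ) (r : F) :
    diagGL F (a, b) * lowerGL r * (diagGL F (a, b))⁻¹ = lowerGL (b * r * (a⁻¹ : Fˣ)) := by
  rw [diagGL_mul_lowerGL, mul_inv_cancel_right]

/-- An automorphism of `GL₂(F)` that fixes `x = 1 + E₁₂` and takes `y = 1 + E₂₁` to `1 + c E₂₁` acts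
on the elementary unipotent matrices through a field automorphism: the torus is determined
by `x` and `y`, so it is stable, and it acts on the two root groups by scaling. -/
theorem exists_ringEquiv_of_fix_unipotents [Finite F] {ψ : MulAut (GL (Fin 2) F)} {c : Fˣ}
    (h1 : ψ (upperGL 1) = upperGL 1) (h2 : ψ (lowerGL 1) = lowerGL (c : F)) :
    ∃ ρ : F ≃+* F, ∀ a, ψ (upperGL a) = upperGL (ρ a) ∧ ψ (lowerGL a) = lowerGL (ρ a) := by
  have hT : ∀ a : Fˣ, ∃ x : Fˣ × Fˣ, ψ (diagGL F (a, 1)) = diagGL F x := by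
    intro a
    obtain ⟨k1, k2⟩ := (mem_torus_iff_commute one_ne_zero (diagGL F (a, 1))).mp ⟨_, rfl⟩
    have k1' := k1.map ψ
    have k2' := k2.map ψ
    simp only [map_mul, map_inv, h1, h2] at k1' k2'
    obtain ⟨x, hx⟩ := (mem_torus_iff_commute c.ne_zero _).mpr ⟨k1', k2'⟩
    exact ⟨x, hx.symm⟩
  have hroot : ∀ a : F, ∃ b : F, ψ (upperGL a) = upperGL b ∧ ψ (lowerGL a) = lowerGL (c * b) ∧
      ∀ r s, ψ (upperGL r) = upperGL s → ψ (upperGL (a * r)) = upperGL (b * s) := by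
    intro a
    by_cases ha : a = 0
    · refine ⟨0, ?_, ?_, ?_⟩
      · rw [ha, upperGL_zero, map_one]
      · rw [ha, lowerGL_zero, map_one, mul_zero, lowerGL_zero]
      · intro r s _
        rw [ha, zero_mul, zero_mul, upperGL_zero, map_one]
    · obtain ⟨⟨α, β⟩, hx⟩ := hT (Units.mk0 a ha)
      have hx' : ψ (diagGL F ((Units.mk0 a ha)⁻¹, 1)) = diagGL F (α⁻¹, β⁻¹) := by
        have e1 : diagGL F ((Units.mk0 a ha)⁻¹, 1) = (diagGL F (Units.mk0 a ha, 1))⁻¹ := by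
          rw [← map_inv]; simp
        rw [e1, map_inv, hx, ← map_inv]; rfl
      have hmul : ∀ r s, ψ (upperGL r) = upperGL s →
          ψ (upperGL (a * r)) = upperGL (α * (β⁻¹ : Fˣ) * s) := by
        intro r s hrs
        have e := diagGL_conj_upperGL (Units.mk0 a ha) 1 r
        have e' := congrArg ψ e
        rw [map_mul, map_mul, map_inv, hx, hrs, diagGL_conj_upperGL] at e'
        simp only [Units.val_mk0, inv_one, Units.val_one, mul_one] at e'
        rw [← e', mul_right_comm]
      refine ⟨α * (β⁻¹ : Fˣ), ?_, ?_, hmul⟩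
      · simpa using hmul 1 1 h1
      · have e := diagGL_conj_lowerGL (Units.mk0 a ha)⁻¹ 1 1
        have e' := congrArg ψ e
        rw [map_mul, map_mul, map_inv, hx', h2, diagGL_conj_lowerGL] at e'
        simp only [Units.val_mk0, inv_inv, Units.val_one, mul_one, one_mul] at e'
        rw [← e']
        congr 1
        ring
  choose f hU hL hmul using hroot
  have hc : (c : F) = 1 := by
    -- the element `s = x y⁻¹ x` conjugates `x` to `y⁻¹`
    have e : sGL F * upperGL 1 = lowerGL (-1) * sGL F := by
      apply GL_ext <;> simp [mul_val_apply, coe_sGL, coe_upperGL, coe_lowerGL]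
    have h2' : ψ (lowerGL (-1)) = lowerGL (-(c : F)) := by
      rw [← lowerGL_inv, map_inv, h2, lowerGL_inv]
    have e' := congrArg ψ e
    simp only [sGL, map_mul, h1, h2'] at e'
    have e'' := congrArg (fun g : GL (Fin 2) F => g.val 0 1) e'
    simp only [mul_val_apply, coe_upperGL, coe_lowerGL, Matrix.of_apply, Matrix.cons_val',
      Matrix.cons_val_zero, Matrix.cons_val_one, Matrix.cons_val_fin_one] at e''
    linear_combination -e''
  have hone : f 1 = 1 := upperGL_injective ((hU 1).symm.trans h1)
  have hzero : f 0 = 0 := upperGL_injective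
    ((hU 0).symm.trans (by rw [upperGL_zero, map_one]))
  let fHom : F →+* F :=
    { toFun := f
      map_one' := hone
      map_zero' := hzero
      map_mul' := fun a b => upperGL_injective
        ((hU (a * b)).symm.trans (hmul a b (f b) (hU b)))
      map_add' := fun a b => upperGL_injective (by
        rw [← hU, ← upperGL_mul, map_mul, hU, hU, upperGL_mul]) }
  refine ⟨RingEquiv.ofBijective fHom (Finite.injective_iff_bijective.mp fHom.injective),
    fun a => ⟨hU a, ?_⟩⟩
  rw [hL, hc, one_mul]
  rfl

/-- An automorphism of `GL₂(F)` that fixes the elementary unipotent matrices is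
`g ↦ χ(det g) g` for some `χ`. -/
theorem exists_eq_detTwist {ψ : MulAut (GL (Fin 2) F)} (hU : ∀ a, ψ (upperGL a) = upperGL a)
    (hL : ∀ a, ψ (lowerGL a) = lowerGL a) :
    ∃ χ : Fˣ →* Fˣ, ∀ g, ψ g = detTwist χ g := by
  have hT : ∀ a : Fˣ, ∃ z : Fˣ, ψ (diagGL F (a, 1)) = diagGL F (z * a, z) := by
    intro a
    obtain ⟨k1, k2⟩ := (mem_torus_iff_commute one_ne_zero (diagGL F (a, 1))).mp ⟨_, rfl⟩
    have k1' := k1.map ψ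
    have k2' := k2.map ψ
    simp only [map_mul, map_inv, hU, hL] at k1' k2'
    obtain ⟨⟨α, β⟩, hx⟩ := (mem_torus_iff_commute one_ne_zero _).mpr ⟨k1', k2'⟩
    refine ⟨β, ?_⟩
    have e := congrArg ψ (diagGL_conj_upperGL a 1 1)
    rw [map_mul, map_mul, map_inv, ← hx, hU, hU, diagGL_conj_upperGL] at e
    have e' := upperGL_injective e
    rw [← hx]
    congr 2
    apply Units.ext
    have hβ : (β : F) * ((β⁻¹ : Fˣ) : F) = 1 := Units.mul_inv β
    simp only [mul_one, inv_one, Units.val_one] at e'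
    rw [Units.val_mul]
    linear_combination (β : F) * e' - α * hβ
  choose z hz using hT
  let χ : Fˣ →* Fˣ := MonoidHom.mk' z (fun a b => by
    have e : diagGL F (a * b, 1) = diagGL F (a, 1) * diagGL F (b, 1) := by
      rw [← map_mul, Prod.mk_mul_mk, one_mul]
    have e' := congrArg ψ e
    rw [map_mul, hz, hz, hz, ← map_mul] at e'
    exact congrArg Prod.snd (diagGL_injective e'))
  refine ⟨χ, fun g => ?_⟩
  have hs : ψ (sGL F) = sGL F := by simp only [sGL, map_mul, hU, hL]
  have h1 : ∀ a, ψ (diagGL F (a, 1)) = detTwist χ (diagGL F (a, 1)) := by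
    intro a
    rw [hz, detTwist_diagGL, mul_one, mul_one]
    rfl
  have htop : ψ.toMonoidHom.eqLocus (detTwist χ) = ⊤ := by
    apply eq_top_of_elementary_mem_field
    · intro a
      exact (hU a).trans (detTwist_of_det_eq_one χ (det_upperGL a)).symm
    · intro a
      exact (hL a).trans (detTwist_of_det_eq_one χ (det_lowerGL a)).symm
    · rintro ⟨a, b⟩
      have e : diagGL F (a, b) =
          diagGL F (a, 1) * (sGL F * diagGL F (b, 1) * (sGL F)⁻¹) := by
        rw [sGL_conj_diagGL, ← map_mul, Prod.mk_mul_mk, mul_one, one_mul]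
      change ψ _ = detTwist χ _
      rw [e]
      simp only [map_mul, map_inv, h1, hs, detTwist_of_det_eq_one χ det_sGL]
  have hg : g ∈ ψ.toMonoidHom.eqLocus (detTwist χ) := by rw [htop]; exact Subgroup.mem_top g
  exact hg

/-- Every automorphism of `GL₂(F)`, for a finite field `F`, is the product of an inner automorphism,
a twist by a power of the determinant, and a field automorphism. -/
theorem exists_conj_mul_eq_detTwist_mul_entryAut [Finite F] (ψ : MulAut (GL (Fin 2) F)) :
    ∃ (g : GL (Fin 2) F) (χ : Fˣ →* Fˣ) (ρ : F ≃+* F),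
      ∀ x, (MulAut.conj g * ψ) x = detTwist χ (entryAut ρ x) := by
  obtain ⟨p, hp⟩ := CharP.exists F
  have : Fact p.Prime := ⟨CharP.char_is_prime F p⟩
  obtain ⟨g, c, h1, h2⟩ := exists_conj_unipotents (R := F) p (φ := ψ.toMonoidHom)
    ψ.injective (fun h => isUnit_iff_ne_zero.mpr h)
  obtain ⟨ρ, hρ⟩ := exists_ringEquiv_of_fix_unipotents (ψ := MulAut.conj g * ψ) h1 h2
  obtain ⟨χ, hχ⟩ := exists_eq_detTwist (ψ := MulAut.conj g * ψ * (entryAut ρ)⁻¹)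
    (fun a => by
      have : (entryAut ρ)⁻¹ (upperGL a) = upperGL (ρ.symm a) := by
        rw [MulAut.inv_apply, MulEquiv.symm_apply_eq, entryAut_upperGL, RingEquiv.apply_symm_apply]
      rw [MulAut.mul_apply, this, (hρ _).1, RingEquiv.apply_symm_apply])
    (fun a => by
      have : (entryAut ρ)⁻¹ (lowerGL a) = lowerGL (ρ.symm a) := by
        rw [MulAut.inv_apply, MulEquiv.symm_apply_eq, entryAut_lowerGL, RingEquiv.apply_symm_apply]
      rw [MulAut.mul_apply, this, (hρ _).2, RingEquiv.apply_symm_apply])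
  refine ⟨g, χ, ρ, fun x => ?_⟩
  rw [← hχ]
  change _ = (MulAut.conj g * ψ) ((entryAut ρ)⁻¹ (entryAut ρ x))
  rw [MulAut.inv_apply_self]

/-- All automorphisms of `GL₂` over the field with two elements are inner. -/
theorem outClass_eq_one_of_units_subsingleton [Finite F] [Subsingleton Fˣ]
    (ψ : MulAut (GL (Fin 2) F)) : outClass (GL (Fin 2) F) ψ = 1 := by
  obtain ⟨g, χ, ρ, h⟩ := exists_conj_mul_eq_detTwist_mul_entryAut ψ
  have h01 : ∀ a : F, a = 0 ∨ a = 1 := by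
    intro a
    by_cases ha : a = 0
    · exact Or.inl ha
    · exact Or.inr (congrArg Units.val (Subsingleton.elim (Units.mk0 a ha) 1))
  have hρ : ∀ a, ρ a = a := by
    intro a
    rcases h01 a with rfl | rfl <;> simp
  have e : MulAut.conj g * ψ = 1 := by
    ext x : 1
    rw [h, detTwist_of_det_eq_one χ (Subsingleton.elim _ _), MulAut.one_apply]
    apply GL_ext <;> rw [entryAut_val, hρ]
  have e' := congrArg (outClass (GL (Fin 2) F)) e
  rwa [map_mul, outClass_conj, one_mul, map_one] at e'

end Classification

/-! ### A quadratic character that is nontrivial at `-1` -/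

section OddCharacter

/-- The Jacobi symbol as a homomorphism on the units modulo `n`. -/
theorem exists_hom_jacobi (n : ℕ) [NeZero n] (hn : n % 4 = 3) :
    ∃ θ : (ZMod n)ˣ →* ℤˣ, θ (-1) = -1 := by
  let f : (ZMod n)ˣ →* ℤ :=
    { toFun := fun a => jacobiSym (a.val.val : ℤ) n
      map_one' := by
        have : Fact (1 < n) := ⟨by omega⟩
        simp [ZMod.val_one]
      map_mul' := fun a b => by
        rw [← jacobiSym.mul_left]
        apply jacobiSym.mod_left'
        rw [Units.val_mul, ZMod.val_mul]
        push_cast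
        exact Int.emod_emod_of_dvd _ dvd_rfl }
  refine ⟨f.toHomUnits, Units.ext ?_⟩
  change jacobiSym (((-1 : (ZMod n)ˣ) : ZMod n).val : ℤ) n = -1
  have hodd : Odd n := Nat.odd_iff.mpr (by omega)
  rw [← ZMod.χ₄_nat_three_mod_four hn, ← jacobiSym.at_neg_one hodd]
  apply jacobiSym.mod_left'
  rw [Units.val_neg, Units.val_one]
  have h1 : ((-1 : ZMod n).val : ℤ) = n - 1 := by
    obtain ⟨m, rfl⟩ : ∃ m, n = m + 1 := ⟨n - 1, by omega⟩
    rw [ZMod.val_neg_one]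
    push_cast
    ring
  rw [h1, sub_eq_neg_add, Int.add_emod_right]

/-- For `n = |Fˣ| > 1` there is a quadratic character modulo `2n` that is nontrivial at `-1`: the
character modulo `4` if `n` is even, and the Jacobi symbol modulo `n` if `n` is odd, in which case
`n + 1 = |F|` is a power of two and so `n ≡ 3` modulo `4`. -/
theorem exists_odd_character (F : Type*) [Field F] [Finite F] (hF : Nat.card F ≠ 2) :
    ∃ θ : (ZMod (2 * Nat.card Fˣ))ˣ →* ℤˣ, θ (-1) = -1 := by
  have : Fintype F := Fintype.ofFinite F
  have hcard : Nat.card Fˣ + 1 = Nat.card F := by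
    rw [Nat.card_units]
    have := Finite.one_lt_card (α := F)
    omega
  generalize Nat.card Fˣ = n at hcard
  have hn : 0 < n := by
    have := Finite.one_lt_card (α := F)
    omega
  have : NeZero n := ⟨hn.ne'⟩
  rcases Nat.even_or_odd n with he | ho
  · obtain ⟨m, hm⟩ := he
    refine ⟨(ZMod.χ₄.toUnitHom).comp (ZMod.unitsMap (⟨m, by omega⟩ : 4 ∣ 2 * n)), ?_⟩
    have h1 : ZMod.unitsMap (⟨m, by omega⟩ : 4 ∣ 2 * n) (-1) = -1 := by
      apply Units.ext
      rw [ZMod.unitsMap_val, Units.val_neg, Units.val_one,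
        ZMod.cast_neg (⟨m, by omega⟩ : 4 ∣ 2 * n), ZMod.cast_one (⟨m, by omega⟩ : 4 ∣ 2 * n)]
      simp
    rw [MonoidHom.comp_apply, h1]
    decide
  · obtain ⟨p, k, hp, hpk⟩ : ∃ (p : ℕ) (k : ℕ+), p.Prime ∧ Nat.card F = p ^ (k : ℕ) := by
      obtain ⟨p, hp⟩ := CharP.exists F
      obtain ⟨k, hp', hk⟩ := FiniteField.card F p
      exact ⟨p, k, hp', by rw [Nat.card_eq_fintype_card, hk]⟩
    have heven : Even (p ^ (k : ℕ)) := by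
      rw [← hpk, ← hcard]
      exact ho.add_one
    have hp2 : p = 2 := (hp.even_iff).mp (Nat.even_pow.mp heven).1
    subst hp2
    have hk : ∃ j, (k : ℕ) = j + 2 := by
      refine ⟨k - 2, ?_⟩
      have h0 := k.pos
      have h1 : (k : ℕ) ≠ 1 := by
        intro h1
        rw [h1] at hpk
        exact hF (by simpa using hpk)
      omega
    obtain ⟨j, hj⟩ := hk
    have hn4 : n % 4 = 3 := by
      have : n + 1 = 4 * 2 ^ j := by rw [hcard, hpk, hj, pow_add]; ring
      omega
    obtain ⟨θ, hθ⟩ := exists_hom_jacobi n hn4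
    refine ⟨θ.comp (ZMod.unitsMap (Dvd.intro_left 2 rfl : n ∣ 2 * n)), ?_⟩
    have h1 : ZMod.unitsMap (Dvd.intro_left 2 rfl : n ∣ 2 * n) (-1) = -1 := by
      apply Units.ext
      rw [ZMod.unitsMap_val]
      simp
    rw [MonoidHom.comp_apply, h1, hθ]

end OddCharacter

/-! ### A group of representatives of the outer classes of `GL₂(F)` -/

section PowerTwists

variable {F : Type*} [Field F]

theorem pow_eq_pow_of_cast_eq {k l : ℕ}
    (h : ((2 * k + 1 : ℕ) : ZMod (2 * Nat.card Fˣ)) = ((2 * l + 1 : ℕ) : ZMod (2 * Nat.card Fˣ)))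
    (a : Fˣ) : a ^ k = a ^ l := by
  rw [ZMod.natCast_eq_natCast_iff] at h
  have h' := Nat.ModEq.mul_left_cancel' two_ne_zero (Nat.ModEq.add_right_cancel' 1 h)
  exact pow_eq_pow_iff_modEq.mpr (h'.of_dvd (orderOf_dvd_natCard a))

theorem detTwist_pow_comp (k l : ℕ) (g : GL (Fin 2) F) :
    detTwist (powMonoidHom k) (detTwist (powMonoidHom l) g) =
      detTwist (powMonoidHom (k * (2 * l + 1) + l)) g := by
  rw [detTwist_apply (powMonoidHom k : Fˣ →* Fˣ), detTwist_apply (powMonoidHom l : Fˣ →* Fˣ),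
    map_mul, det_diagGL, ← mul_assoc, ← map_mul, detTwist_apply]
  simp only [powMonoidHom_apply, Prod.mk_mul_mk]
  have e : ∀ d : Fˣ, (d ^ l * d ^ l * d) ^ k * d ^ l = d ^ (k * (2 * l + 1) + l) := by
    intro d
    rw [pow_add, ← pow_add, ← pow_succ, ← pow_mul]
    congr 2
    ring
  rw [e]

theorem detTwist_pow_congr {k l : ℕ}
    (h : ((2 * k + 1 : ℕ) : ZMod (2 * Nat.card Fˣ)) = ((2 * l + 1 : ℕ) : ZMod (2 * Nat.card Fˣ)))
    (g : GL (Fin 2) F) : detTwist (powMonoidHom k) g = detTwist (powMonoidHom l) g := by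
  rw [detTwist_apply, detTwist_apply, powMonoidHom_apply, powMonoidHom_apply,
    pow_eq_pow_of_cast_eq h]

theorem detTwist_pow_zero (g : GL (Fin 2) F) : detTwist (powMonoidHom 0) g = g := by
  rw [detTwist_apply, powMonoidHom_apply, pow_zero]
  exact (congrArg (· * g) (map_one (diagGL F))).trans (one_mul g)

/-- The action of ring automorphisms on the entries, as a homomorphism. -/
def entryHom (F : Type*) [Field F] : (F ≃+* F) →* MulAut (GL (Fin 2) F) where
  toFun := entryAut
  map_one' := by ext g : 1; rfl
  map_mul' ρ σ := by ext g : 1; rfl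

theorem det_entryAut (ρ : F ≃+* F) (g : GL (Fin 2) F) :
    Matrix.GeneralLinearGroup.det (entryAut ρ g) =
      Units.map (ρ : F →* F) (Matrix.GeneralLinearGroup.det g) := by
  apply Units.ext
  rw [det_val, Units.coe_map, det_val]
  simp [entryAut_val]

theorem entryAut_diagGL (ρ : F ≃+* F) (a b : Fˣ) : entryAut ρ (diagGL F (a, b)) =
    diagGL F (Units.map (ρ : F →* F) a, Units.map (ρ : F →* F) b) := by
  apply GL_ext <;> simp [entryAut_val, coe_diagGL]

theorem sGL_conj_mul_self : MulAut.conj (sGL F) * MulAut.conj (sGL F) = 1 := by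
  rw [← map_mul]
  have e : sGL F * sGL F = diagGL F (-1, -1) := by
    apply GL_ext <;> simp [mul_val_apply, coe_sGL, coe_diagGL]
  ext x : 1
  rw [e, MulAut.conj_apply, commute_scalar, mul_inv_cancel_right, MulAut.one_apply]

/-- The action of the group of signs for which `-1` acts by conjugation by the matrix `sGL`. -/
def signConj (F : Type*) [Field F] : ℤˣ →* MulAut (GL (Fin 2) F) where
  toFun ε := if ε = 1 then 1 else MulAut.conj (sGL F)
  map_one' := if_pos rfl
  map_mul' ε δ := by
    rcases Int.units_eq_one_or ε with rfl | rfl <;> rcases Int.units_eq_one_or δ with rfl | rfl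
    · simp
    · simp
    · simp
    · simpa using sGL_conj_mul_self.symm

theorem signConj_neg_one : signConj F (-1) = MulAut.conj (sGL F) := by
  change (if (-1 : ℤˣ) = 1 then 1 else MulAut.conj (sGL F)) = _
  exact if_neg (by decide)

theorem exists_signConj_eq_conj (ε : ℤˣ) :
    ∃ g : GL (Fin 2) F, signConj F ε = MulAut.conj g := by
  rcases Int.units_eq_one_or ε with rfl | rfl
  · exact ⟨1, by rw [map_one, map_one]⟩
  · exact ⟨_, signConj_neg_one⟩

theorem signConj_commute {ψ : MulAut (GL (Fin 2) F)} (hψ : ψ (sGL F) = sGL F) (ε : ℤˣ) :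
    Commute (signConj F ε) ψ := by
  rcases Int.units_eq_one_or ε with rfl | rfl
  · rw [map_one]; exact Commute.one_left _
  · rw [signConj_neg_one, commute_iff_eq, mulAut_mul_conj, hψ]

theorem entryHom_sGL (ρ : F ≃+* F) : entryHom F ρ (sGL F) = sGL F := by
  change entryAut ρ (sGL F) = sGL F
  apply GL_ext <;> simp [entryAut_val, coe_sGL]

theorem map_eq_of_forall_mem {G : Type*} [Group G] {H : Subgroup G} {W : Subgroup (MulAut G)}
    (h : ∀ f ∈ W, ∀ g ∈ H, f g ∈ H) : ∀ f ∈ W, H.map f.toMonoidHom = H := by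
  intro f hf
  apply le_antisymm
  · rintro _ ⟨g, hg, rfl⟩
    exact h f hf g hg
  · intro g hg
    exact ⟨f⁻¹ g, h _ (W.inv_mem hf) g hg, MulAut.apply_inv_self _ f g⟩

variable [Finite F]

instance : NeZero (2 * Nat.card Fˣ) := ⟨Nat.mul_ne_zero two_ne_zero Nat.card_pos.ne'⟩

/-- The exponent `(m - 1) / 2` attached to a unit `m` modulo `2 |Fˣ|`. -/
noncomputable def halfExp (m : (ZMod (2 * Nat.card Fˣ))ˣ) : ℕ := m.val.val / 2

theorem two_mul_halfExp_add_one (m : (ZMod (2 * Nat.card Fˣ))ˣ) :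
    ((2 * halfExp m + 1 : ℕ) : ZMod (2 * Nat.card Fˣ)) = m.val := by
  have hodd : Odd m.val.val := by
    rw [← Nat.coprime_two_right]
    exact Nat.Coprime.coprime_mul_right_right (ZMod.val_coe_unit_coprime m)
  rw [halfExp, Nat.two_mul_div_two_add_one_of_odd hodd, ZMod.natCast_zmod_val]

theorem detTwist_halfExp_mul (m m' : (ZMod (2 * Nat.card Fˣ))ˣ) (g : GL (Fin 2) F) :
    detTwist (powMonoidHom (halfExp m)) (detTwist (powMonoidHom (halfExp m')) g) =
      detTwist (powMonoidHom (halfExp (m * m'))) g := by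
  rw [detTwist_pow_comp]
  apply detTwist_pow_congr
  rw [two_mul_halfExp_add_one, Units.val_mul, ← two_mul_halfExp_add_one m,
    ← two_mul_halfExp_add_one m']
  push_cast
  ring

theorem detTwist_halfExp_one (g : GL (Fin 2) F) :
    detTwist (powMonoidHom (halfExp (1 : (ZMod (2 * Nat.card Fˣ))ˣ))) g = g :=
  (detTwist_pow_congr (l := 0) (by rw [two_mul_halfExp_add_one]; simp) g).trans
    (detTwist_pow_zero g)

/-- The automorphisms `g ↦ det(g) ^ ((m - 1) / 2) g`, for the units `m` modulo `2 |Fˣ|`. Such an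
automorphism raises determinants to the power `m`, which makes this a homomorphism. -/
noncomputable def powTwist (F : Type*) [Field F] [Finite F] :
    (ZMod (2 * Nat.card Fˣ))ˣ →* MulAut (GL (Fin 2) F) where
  toFun m :=
    { detTwist (powMonoidHom (halfExp m)) with
      invFun := detTwist (powMonoidHom (halfExp m⁻¹))
      left_inv := fun g => by
        change detTwist _ (detTwist _ g) = g
        rw [detTwist_halfExp_mul, inv_mul_cancel, detTwist_halfExp_one]
      right_inv := fun g => by
        change detTwist _ (detTwist _ g) = g
        rw [detTwist_halfExp_mul, mul_inv_cancel, detTwist_halfExp_one] }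
  map_one' := by
    ext g : 1
    exact detTwist_halfExp_one g
  map_mul' m m' := by
    ext g : 1
    exact (detTwist_halfExp_mul m m' g).symm

theorem powTwist_apply (m : (ZMod (2 * Nat.card Fˣ))ˣ) (g : GL (Fin 2) F) :
    powTwist F m g = detTwist (powMonoidHom (halfExp m)) g := rfl

/-- A twist by a power of the determinant is an automorphism only if it is one of the `powTwist`s:
it acts on scalar matrices by `a ↦ a ^ (2k + 1)`, so injectivity makes `2k + 1` prime to `|Fˣ|`. -/
theorem exists_powTwist_eq {χ : Fˣ →* Fˣ} (hχ : Function.Injective (detTwist χ)) :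
    ∃ m, ∀ g, powTwist F m g = detTwist χ g := by
  obtain ⟨r, hr⟩ := MonoidHom.map_cyclic χ
  obtain ⟨k, hk⟩ : ∃ k : ℕ, χ = powMonoidHom k := by
    have h0 : 0 ≤ r % (Nat.card Fˣ : ℤ) :=
      Int.emod_nonneg _ (by exact_mod_cast Nat.card_pos.ne')
    refine ⟨(r % (Nat.card Fˣ : ℤ)).toNat, MonoidHom.ext fun a => ?_⟩
    rw [powMonoidHom_apply, hr, ← zpow_natCast, Int.toNat_of_nonneg h0, zpow_mod_natCard]
  subst hk
  obtain ⟨ζ, hζ⟩ := IsCyclic.exists_generator (α := Fˣ)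
  have hord := orderOf_eq_card_of_forall_mem_zpowers hζ
  have hcop : (2 * k + 1).Coprime (Nat.card Fˣ) := by
    obtain ⟨e, he⟩ := Nat.gcd_dvd_right (2 * k + 1) (Nat.card Fˣ)
    obtain ⟨f, hf⟩ := Nat.gcd_dvd_left (2 * k + 1) (Nat.card Fˣ)
    have h1 : (ζ ^ e) ^ (2 * k + 1) = 1 := by
      rw [← pow_mul, ← orderOf_dvd_iff_pow_eq_one, hord]
      refine ⟨f, ?_⟩
      conv_lhs => rw [hf]
      conv_rhs => rw [he]
      ring
    have h2 : ζ ^ e = 1 := by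
      have h3 : detTwist (powMonoidHom k) (diagGL F (ζ ^ e, ζ ^ e)) =
          detTwist (powMonoidHom k) (diagGL F (1, 1)) := by
        rw [detTwist_diagGL, detTwist_diagGL, powMonoidHom_apply, powMonoidHom_apply,
          ← pow_two, ← pow_mul, ← pow_succ, h1]
        simp
      exact congrArg Prod.fst (diagGL_injective (hχ h3))
    rw [← orderOf_dvd_iff_pow_eq_one, hord] at h2
    have hpos : 0 < e := Nat.pos_of_ne_zero (by
      rintro rfl
      exact Nat.card_pos.ne' (he.trans (mul_zero _)))
    have hle := Nat.le_of_dvd hpos h2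
    have hle' : Nat.gcd (2 * k + 1) (Nat.card Fˣ) * e ≤ 1 * e := by rw [← he, one_mul]; exact hle
    have hg := Nat.le_of_mul_le_mul_right hle' hpos
    exact le_antisymm hg (Nat.gcd_pos_of_pos_left _ (Nat.succ_pos _))
  have hcop2 : (2 * k + 1).Coprime (2 * Nat.card Fˣ) :=
    Nat.Coprime.mul_right (Nat.coprime_two_right.mpr ⟨k, rfl⟩) hcop
  refine ⟨ZMod.unitOfCoprime _ hcop2, fun g => ?_⟩
  rw [powTwist_apply]
  apply detTwist_pow_congr
  rw [two_mul_halfExp_add_one, ZMod.coe_unitOfCoprime]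

theorem powTwist_commute_entryHom (m : (ZMod (2 * Nat.card Fˣ))ˣ) (ρ : F ≃+* F) :
    Commute (powTwist F m) (entryHom F ρ) := by
  ext g : 1
  change powTwist F m (entryAut ρ g) = entryAut ρ (powTwist F m g)
  rw [powTwist_apply, powTwist_apply, detTwist_apply, detTwist_apply, map_mul, entryAut_diagGL,
    det_entryAut, powMonoidHom_apply, powMonoidHom_apply, map_pow]

theorem powTwist_sGL (m : (ZMod (2 * Nat.card Fˣ))ˣ) : powTwist F m (sGL F) = sGL F :=
  detTwist_of_det_eq_one _ det_sGL

/-- The homomorphism `(m, ρ) ↦ conj(s) ^ θ(m) ∘ powTwist m ∘ ρ`, for a quadratic character `θ`. -/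
noncomputable def representativeHom (θ : (ZMod (2 * Nat.card Fˣ))ˣ →* ℤˣ) :
    (ZMod (2 * Nat.card Fˣ))ˣ × (F ≃+* F) →* MulAut (GL (Fin 2) F) :=
  MonoidHom.mk' (fun x => signConj F (θ x.1) * (powTwist F x.1 * entryHom F x.2)) (by
    rintro ⟨m, ρ⟩ ⟨m', ρ'⟩
    have h : powTwist F (m * m') * entryHom F (ρ * ρ') =
        powTwist F m * entryHom F ρ * (powTwist F m' * entryHom F ρ') := by
      rw [map_mul, map_mul, mul_assoc, mul_assoc, ← mul_assoc (powTwist F m') (entryHom F ρ),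
        (powTwist_commute_entryHom m' ρ).eq, mul_assoc]
    have h' : Commute (signConj F (θ m')) (powTwist F m * entryHom F ρ) :=
      signConj_commute (by rw [MulAut.mul_apply, entryHom_sGL, powTwist_sGL]) _
    change signConj F (θ (m * m')) * (powTwist F (m * m') * entryHom F (ρ * ρ')) = _
    rw [h, map_mul, map_mul, mul_assoc, ← mul_assoc (signConj F (θ m')), h'.eq]
    simp only [mul_assoc])

theorem representativeHom_apply (θ : (ZMod (2 * Nat.card Fˣ))ˣ →* ℤˣ)
    (m : (ZMod (2 * Nat.card Fˣ))ˣ) (ρ : F ≃+* F) :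
    representativeHom θ (m, ρ) = signConj F (θ m) * (powTwist F m * entryHom F ρ) := rfl

theorem representativeHom_mem_torus (θ : (ZMod (2 * Nat.card Fˣ))ˣ →* ℤˣ)
    (x : (ZMod (2 * Nat.card Fˣ))ˣ × (F ≃+* F)) {g : GL (Fin 2) F} (hg : g ∈ torus F) :
    representativeHom θ x g ∈ torus F := by
  obtain ⟨m, ρ⟩ := x
  obtain ⟨⟨a, b⟩, rfl⟩ := hg
  obtain ⟨⟨c, d⟩, h⟩ : powTwist F m (entryHom F ρ (diagGL F (a, b))) ∈ torus F := by
    change powTwist F m (entryAut ρ (diagGL F (a, b))) ∈ torus F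
    rw [entryAut_diagGL, powTwist_apply, detTwist_diagGL]
    exact ⟨_, rfl⟩
  rw [representativeHom_apply, MulAut.mul_apply, MulAut.mul_apply, ← h]
  rcases Int.units_eq_one_or (θ m) with e | e
  · rw [e, map_one]
    exact ⟨_, rfl⟩
  · rw [e, signConj_neg_one, MulAut.conj_apply, sGL_conj_diagGL]
    exact ⟨_, rfl⟩

/-- The image of `representativeHom θ` meets the inner automorphisms trivially: up to a conjugation
its members fix the elementary unipotent matrices `x` and `y`. -/
theorem eq_one_of_representativeHom_inner {θ : (ZMod (2 * Nat.card Fˣ))ˣ →* ℤˣ}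
    {x : (ZMod (2 * Nat.card Fˣ))ˣ × (F ≃+* F)}
    (h : outClass (GL (Fin 2) F) (representativeHom θ x) = 1) : x = 1 := by
  obtain ⟨m, ρ⟩ := x
  obtain ⟨s, hs⟩ := exists_signConj_eq_conj (F := F) (θ m)
  rw [representativeHom_apply, hs, map_mul, outClass_conj, one_mul] at h
  obtain ⟨g, hg⟩ := (QuotientGroup.eq_one_iff _).mp h
  have happly : ∀ y, MulAut.conj g y = detTwist (powMonoidHom (halfExp m)) (entryAut ρ y) :=
    fun y => congrArg (fun f : MulAut (GL (Fin 2) F) => f y) hg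
  have hU : ∀ a, MulAut.conj g (upperGL a) = upperGL (ρ a) := fun a => by
    rw [happly, entryAut_upperGL, detTwist_of_det_eq_one _ (det_upperGL _)]
  have hL : ∀ a, MulAut.conj g (lowerGL a) = lowerGL (ρ a) := fun a => by
    rw [happly, entryAut_lowerGL, detTwist_of_det_eq_one _ (det_lowerGL _)]
  have hg1 : MulAut.conj g = 1 := conj_eq_one_of_fix_unipotents
    (by rw [hU, map_one]) (by rw [hL, map_one])
  have hρ : ρ = 1 := by
    ext a
    apply upperGL_injective
    rw [← hU, hg1]
    rfl
  subst hρ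
  have hm : m = 1 := by
    obtain ⟨ζ, hζ⟩ := IsCyclic.exists_generator (α := Fˣ)
    have hord := orderOf_eq_card_of_forall_mem_zpowers hζ
    have e := happly (diagGL F (ζ, 1))
    rw [hg1, entryAut_diagGL, detTwist_diagGL, MulAut.one_apply] at e
    have e' := congrArg Prod.snd (diagGL_injective e)
    have hζ1 : ζ ^ halfExp m = 1 := by
      have e2 : ((1 : F ≃+* F) : F →* F) = MonoidHom.id F := rfl
      rw [e2, Units.map_id, MonoidHom.id_apply, MonoidHom.id_apply, mul_one, mul_one,
        powMonoidHom_apply] at e'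
      exact e'.symm
    rw [← orderOf_dvd_iff_pow_eq_one, hord] at hζ1
    apply Units.ext
    rw [← two_mul_halfExp_add_one, Nat.cast_add,
      (ZMod.natCast_eq_zero_iff _ _).mpr (Nat.mul_dvd_mul_left 2 hζ1)]
    simp
  rw [hm]
  rfl

theorem representsOut_range (θ : (ZMod (2 * Nat.card Fˣ))ˣ →* ℤˣ) :
    RepresentsOut F (representativeHom θ).range where
  stabilises := by
    apply map_eq_of_forall_mem
    rintro _ ⟨x, rfl⟩ g hg
    exact representativeHom_mem_torus θ x hg
  bijective := by
    constructor
    · rw [injective_iff_map_eq_one]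
      rintro ⟨_, x, rfl⟩ h
      have hx := eq_one_of_representativeHom_inner (θ := θ) (x := x) h
      subst hx
      exact Subtype.ext (map_one _)
    · intro c
      obtain ⟨ψ, rfl⟩ := QuotientGroup.mk'_surjective _ c
      obtain ⟨g, χ, ρ, h⟩ := exists_conj_mul_eq_detTwist_mul_entryAut ψ
      have hχ : Function.Injective (detTwist χ) := by
        intro a b hab
        have ha := h ((entryAut ρ)⁻¹ a)
        have hb := h ((entryAut ρ)⁻¹ b)
        rw [MulAut.apply_inv_self] at ha hb
        exact (entryAut ρ)⁻¹.injective
          ((MulAut.conj g * ψ).injective (ha.trans (hab.trans hb.symm)))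
      obtain ⟨m, hm⟩ := exists_powTwist_eq hχ
      obtain ⟨s, hs⟩ := exists_signConj_eq_conj (F := F) (θ m)
      refine ⟨⟨_, (m, ρ), rfl⟩, ?_⟩
      have e : MulAut.conj g * ψ = powTwist F m * entryHom F ρ := by
        ext x : 1
        rw [h, MulAut.mul_apply, hm]
        rfl
      change outClass _ (representativeHom θ (m, ρ)) = outClass _ ψ
      rw [representativeHom_apply, ← e, hs, map_mul, map_mul, outClass_conj, outClass_conj,
        one_mul, one_mul]

/-- In rank two the contragredient is `g ↦ det(g)⁻¹ g` followed by conjugation by `sGL`. -/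
theorem contragredient_eq (θ : (ZMod (2 * Nat.card Fˣ))ˣ →* ℤˣ) (hθ : θ (-1) = -1) :
    representativeHom θ (-1, 1) = contragredient F := by
  ext g : 1
  have hd : Matrix.GeneralLinearGroup.det g ^ halfExp (-1 : (ZMod (2 * Nat.card Fˣ))ˣ) =
      (Matrix.GeneralLinearGroup.det g)⁻¹ := by
    have hn : 0 < Nat.card Fˣ := Nat.card_pos
    rw [pow_eq_pow_of_cast_eq (l := Nat.card Fˣ - 1), eq_inv_iff_mul_eq_one, ← pow_succ,
      Nat.sub_add_cancel hn, pow_card_eq_one']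
    rw [two_mul_halfExp_add_one, Units.val_neg, Units.val_one, neg_eq_iff_add_eq_zero]
    rw [← Nat.cast_one, ← Nat.cast_add, ZMod.natCast_eq_zero_iff]
    exact ⟨1, by omega⟩
  have e : representativeHom θ (-1, 1) g = sGL F * (diagGL F
      ((Matrix.GeneralLinearGroup.det g)⁻¹, (Matrix.GeneralLinearGroup.det g)⁻¹) * g) *
      (sGL F)⁻¹ := by
    rw [representativeHom_apply, hθ, signConj_neg_one, map_one, mul_one, MulAut.mul_apply,
      powTwist_apply, detTwist_apply, powMonoidHom_apply, hd, MulAut.conj_apply]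
  rw [e]
  change _ = (transposeGL g)⁻¹
  have hs : (sGL F)⁻¹ = diagGL F (-1, -1) * sGL F := by
    rw [inv_eq_iff_mul_eq_one]
    apply GL_ext <;> simp [mul_val_apply, coe_sGL, coe_diagGL]
  have key : g * ((sGL F)⁻¹ * transposeGL g) = diagGL F
      (Matrix.GeneralLinearGroup.det g, Matrix.GeneralLinearGroup.det g) * (sGL F)⁻¹ := by
    rw [hs]
    apply GL_ext <;> simp [mul_val_apply, coe_sGL, coe_diagGL, transposeGL, Matrix.det_fin_two] <;>
      ring
  rw [eq_inv_iff_mul_eq_one, mul_assoc, mul_assoc, mul_assoc, key, ← mul_assoc (diagGL F _),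
    ← map_mul, Prod.mk_mul_mk, inv_mul_cancel]
  have h1 : diagGL F (1, 1) = 1 := map_one (diagGL F)
  rw [h1, one_mul, mul_inv_cancel]

theorem frobeniusContragredient_le_range (θ : (ZMod (2 * Nat.card Fˣ))ˣ →* ℤˣ) (hθ : θ (-1) = -1) :
    frobeniusContragredient F ≤ (representativeHom θ).range := by
  rw [frobeniusContragredient, Subgroup.closure_le]
  rintro _ (⟨ρ, rfl⟩ | rfl)
  · refine ⟨(1, ρ), ?_⟩
    rw [representativeHom_apply, map_one, map_one, map_one, one_mul, one_mul]
    rfl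
  · exact ⟨(-1, 1), contragredient_eq θ hθ⟩

theorem exists_representsOut (F : Type*) [Field F] [Finite F] :
    ∃ W : Subgroup (MulAut (GL (Fin 2) F)), RepresentsOut F W ∧
      (Nat.card F ≠ 2 → frobeniusContragredient F ≤ W) := by
  by_cases hF : Nat.card F = 2
  · exact ⟨_, representsOut_range 1, fun h => absurd hF h⟩
  · obtain ⟨θ, hθ⟩ := exists_odd_character F hF
    exact ⟨_, representsOut_range θ, fun _ => frobeniusContragredient_le_range θ hθ⟩

end PowerTwists

/-! ### The action of normalised automorphisms on the torus -/

section TorusStability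

variable {F : Type*} [Field F] {W : Subgroup (MulAut (GL (Fin 2) F))}

theorem RepresentsOut.eq_one_of_outClass_eq_one (hW : RepresentsOut F W)
    {w : MulAut (GL (Fin 2) F)} (hw : w ∈ W) (h : outClass (GL (Fin 2) F) w = 1) : w = 1 := by
  have hw1 : (⟨w, hw⟩ : W) = 1 := hW.bijective.1 (h.trans (map_one _).symm)
  exact congrArg Subtype.val hw1

theorem RepresentsOut.mem_torus (hW : RepresentsOut F W) {w : MulAut (GL (Fin 2) F)} (hw : w ∈ W)
    {g : GL (Fin 2) F} (hg : g ∈ torus F) : w g ∈ torus F := by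
  rw [← hW.stabilises w hw]
  exact ⟨g, hg, rfl⟩

theorem mem_torus_of_commute {R : Type*} [CommRing R] [IsDomain R] {a b : Rˣ} (hab : a ≠ b)
    {g : GL (Fin 2) R} (h : g * diagGL R (a, b) = diagGL R (a, b) * g) : g ∈ torus R := by
  have hab' : (a : R) - b ≠ 0 := fun h => hab (Units.ext (sub_eq_zero.mp h))
  rw [GL_ext_iff] at h
  simp only [mul_val_apply, coe_diagGL, Matrix.of_apply, Matrix.cons_val',
    Matrix.cons_val_zero, Matrix.cons_val_one, Matrix.cons_val_fin_one] at h
  obtain ⟨⟨-, h01⟩, h10, -⟩ := h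
  rw [mem_torus_iff]
  constructor
  · apply mul_left_cancel₀ hab'
    linear_combination -h01
  · apply mul_left_cancel₀ hab'
    linear_combination h10

theorem constUnit_injective : Function.Injective (constUnit F) := fun _ _ h =>
  Units.ext (C_injective (congrArg Units.val h))

/-- The normalised automorphisms stabilise the diagonal torus of `GL₂(F[t,t⁻¹])`. If `F` has more
than two elements, the torus is the centraliser of a constant diagonal matrix. Otherwise `W` is
trivial, and the torus is determined by the two elementary unipotent matrices, which are fixed. -/
theorem mem_torus_of_mem_constRestrict [Finite F] (hW : RepresentsOut F W)
    {φ : MulAut (GL (Fin 2) F[T;T⁻¹])} (hφ : φ ∈ constRestrict W) {g : GL (Fin 2) F[T;T⁻¹]}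
    (hg : g ∈ torus F[T;T⁻¹]) : φ g ∈ torus F[T;T⁻¹] := by
  obtain ⟨w, hw, hφw⟩ := hφ
  rcases subsingleton_or_nontrivial Fˣ with hF | hF
  · have hw1 := hW.eq_one_of_outClass_eq_one hw (outClass_eq_one_of_units_subsingleton w)
    subst hw1
    have h1 : φ (upperGL 1) = upperGL 1 := by
      have := hφw (upperGL 1)
      rwa [MulAut.one_apply, constGL_upperGL, map_one] at this
    have h2 : φ (lowerGL 1) = lowerGL 1 := by
      have := hφw (lowerGL 1)
      rwa [MulAut.one_apply, constGL_lowerGL, map_one] at this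
    obtain ⟨k1, k2⟩ := (mem_torus_iff_commute one_ne_zero g).mp hg
    have k1' := k1.map φ
    have k2' := k2.map φ
    simp only [map_mul, map_inv, h1, h2] at k1' k2'
    exact (mem_torus_iff_commute one_ne_zero _).mpr ⟨k1', k2'⟩
  · obtain ⟨a, ha⟩ := exists_ne (1 : Fˣ)
    obtain ⟨⟨b, c⟩, hbc⟩ := hW.mem_torus hw ⟨(a, 1), rfl⟩
    have hne : b ≠ c := by
      rintro rfl
      apply ha
      have e : diagGL F (a, 1) * upperGL 1 = upperGL 1 * diagGL F (a, 1) := by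
        apply w.injective
        rw [map_mul, map_mul, ← hbc, commute_scalar]
      have e' := congrArg (fun g : GL (Fin 2) F => g.val 0 1) e
      exact Units.ext (by simpa [mul_val_apply, coe_diagGL, coe_upperGL] using e')
    apply mem_torus_of_commute (constUnit_injective.ne hne)
    obtain ⟨x, rfl⟩ := hg
    rw [← constGL_diagGL, hbc, ← hφw, ← map_mul, ← map_mul, constGL_diagGL, ← map_mul, ← map_mul,
      mul_comm]

theorem map_torus_of_mem_constRestrict [Finite F] (hW : RepresentsOut F W) :
    ∀ φ ∈ constRestrict W, (torus F[T;T⁻¹]).map φ.toMonoidHom = torus F[T;T⁻¹] :=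
  map_eq_of_forall_mem fun _ hφ _ hg => mem_torus_of_mem_constRestrict hW hφ hg

theorem map_constGL_range_of_mem_constRestrict :
    ∀ φ ∈ constRestrict W, (constGL F).range.map φ.toMonoidHom = (constGL F).range := by
  apply map_eq_of_forall_mem
  rintro φ ⟨w, -, hφw⟩ _ ⟨g, rfl⟩
  exact ⟨w g, (hφw g).symm⟩

theorem tUnit_ne_one : tUnit F ≠ 1 := by
  intro h
  have e : constUnit F 1 * tUnit F ^ (1 : ℤ) = constUnit F 1 * tUnit F ^ (0 : ℤ) := by simp [h]
  exact one_ne_zero (constUnit_mul_zpow_inj e).2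

/-- The image of `u` under a normalised automorphism acts on the torus in the same way as `u`. -/
theorem map_uGL_conj_diagGL [Finite F] (hW : RepresentsOut F W)
    {φ : MulAut (GL (Fin 2) F[T;T⁻¹])} (hφ : φ ∈ constRestrict W) (a b : (F[T;T⁻¹])ˣ) :
    φ (uGL F[T;T⁻¹]) * diagGL F[T;T⁻¹] (a, b) * (φ (uGL F[T;T⁻¹]))⁻¹ =
      diagGL F[T;T⁻¹] (b, a) := by
  have hφ' := (constRestrict W).inv_mem hφ
  have hM : φ (uGL F[T;T⁻¹]) * diagGL F[T;T⁻¹] (tUnit F, 1) * (φ (uGL F[T;T⁻¹]))⁻¹ ∈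
      torus F[T;T⁻¹] := by
    obtain ⟨⟨c, d⟩, h⟩ := mem_torus_of_mem_constRestrict hW hφ' ⟨(tUnit F, 1), rfl⟩
    have h' : diagGL F[T;T⁻¹] (tUnit F, 1) = φ (diagGL F[T;T⁻¹] (c, d)) := by
      rw [h, MulAut.apply_inv_self]
    rw [h', ← map_inv, ← map_mul, ← map_mul, uGL_conj_diagGL]
    exact mem_torus_of_mem_constRestrict hW hφ ⟨_, rfl⟩
  have hnot : φ (uGL F[T;T⁻¹]) ∉ torus F[T;T⁻¹] := by
    intro h
    have h' := mem_torus_of_mem_constRestrict hW hφ' h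
    rw [MulAut.inv_apply_self, mem_torus_iff] at h'
    simp [coe_uGL] at h'
  obtain ⟨h0, h1⟩ := (mem_torus_or_antidiagonal tUnit_ne_one hM).resolve_left hnot
  exact antidiagonal_conj h0 h1 a b

/-- The diagonal matrix with entries `a tᵐ` and `b tⁿ`. -/
noncomputable def monomialGL (a b : Fˣ) (m n : ℤ) : GL (Fin 2) F[T;T⁻¹] :=
  diagGL F[T;T⁻¹] (constUnit F a * tUnit F ^ m, constUnit F b * tUnit F ^ n)

theorem exists_eq_monomialGL {g : GL (Fin 2) F[T;T⁻¹]} (hg : g ∈ torus F[T;T⁻¹]) :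
    ∃ a b m n, g = monomialGL (F := F) a b m n := by
  obtain ⟨⟨α, β⟩, rfl⟩ := hg
  obtain ⟨a, m, rfl⟩ := exists_eq_constUnit_mul_zpow α
  obtain ⟨b, n, rfl⟩ := exists_eq_constUnit_mul_zpow β
  exact ⟨a, b, m, n, rfl⟩

theorem monomialGL_inj {a b a' b' : Fˣ} {m n m' n' : ℤ}
    (h : monomialGL a b m n = monomialGL a' b' m' n') :
    (a = a' ∧ m = m') ∧ b = b' ∧ n = n' := by
  have e := diagGL_injective h
  exact ⟨constUnit_mul_zpow_inj (congrArg Prod.fst e), constUnit_mul_zpow_inj (congrArg Prod.snd e)⟩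

theorem monomialGL_mul (a b a' b' : Fˣ) (m n m' n' : ℤ) :
    monomialGL a b m n * monomialGL a' b' m' n' =
      monomialGL (a * a') (b * b') (m + m') (n + n') := by
  rw [monomialGL, monomialGL, monomialGL, ← map_mul, Prod.mk_mul_mk, map_mul, map_mul, zpow_add,
    zpow_add, mul_mul_mul_comm, mul_mul_mul_comm (constUnit F b)]

theorem monomialGL_zpow (a b : Fˣ) (m n k : ℤ) :
    monomialGL a b m n ^ k = monomialGL (a ^ k) (b ^ k) (m * k) (n * k) := by
  rw [monomialGL, monomialGL, ← map_zpow (diagGL _), map_zpow (constUnit F),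
    map_zpow (constUnit F), zpow_mul, zpow_mul, ← mul_zpow, ← mul_zpow]
  rfl

theorem monomialGL_inv (a b : Fˣ) (m n : ℤ) :
    (monomialGL a b m n)⁻¹ = monomialGL a⁻¹ b⁻¹ (-m) (-n) := by
  simpa using monomialGL_zpow a b m n (-1)

theorem constGL_diagGL_eq_monomialGL (a b : Fˣ) :
    constGL F (diagGL F (a, b)) = monomialGL a b 0 0 := by
  rw [constGL_diagGL, monomialGL, zpow_zero, mul_one, mul_one]

theorem diagGL_tUnit_eq_monomialGL :
    diagGL F[T;T⁻¹] (tUnit F, 1) = monomialGL 1 1 1 0 := by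
  rw [monomialGL, map_one, zpow_zero, zpow_one, mul_one, one_mul]

theorem uGL_conj_monomialGL (a b : Fˣ) (m n : ℤ) :
    uGL F[T;T⁻¹] * monomialGL a b m n * (uGL F[T;T⁻¹])⁻¹ = monomialGL b a n m :=
  uGL_conj_diagGL _ _

/-- On the torus modulo constants, a free abelian group of rank two, a normalised automorphism acts
by an invertible integral matrix that commutes with the swap of the coordinates. So the matrix has
rows `(m, n)` and `(n, m)` with `(m + n) (m - n) = ± 1`. -/
theorem map_diagGL_tUnit_cases [Finite F] (hW : RepresentsOut F W)
    {φ : MulAut (GL (Fin 2) F[T;T⁻¹])} (hφ : φ ∈ constRestrict W) :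
    ∃ a b : Fˣ, φ (diagGL F[T;T⁻¹] (tUnit F, 1)) = monomialGL a b 1 0 ∨
      φ (diagGL F[T;T⁻¹] (tUnit F, 1)) = monomialGL a b 0 1 ∨
      φ (diagGL F[T;T⁻¹] (tUnit F, 1)) = monomialGL a b (-1) 0 ∨
      φ (diagGL F[T;T⁻¹] (tUnit F, 1)) = monomialGL a b 0 (-1) := by
  have hφ' := (constRestrict W).inv_mem hφ
  obtain ⟨a, b, m, n, h⟩ := exists_eq_monomialGL
    (mem_torus_of_mem_constRestrict hW hφ ⟨(tUnit F, 1), rfl⟩)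
  obtain ⟨a', b', k, l, h'⟩ := exists_eq_monomialGL
    (mem_torus_of_mem_constRestrict hW hφ' ⟨(tUnit F, 1), rfl⟩)
  have hdecomp : monomialGL a' b' k l = constGL F (diagGL F (a', b')) *
      (monomialGL 1 1 1 0 ^ k *
        (uGL F[T;T⁻¹] * monomialGL 1 1 1 0 * (uGL F[T;T⁻¹])⁻¹) ^ l) := by
    rw [uGL_conj_monomialGL, monomialGL_zpow, monomialGL_zpow, constGL_diagGL_eq_monomialGL,
      monomialGL_mul, monomialGL_mul]
    simp
  have hswap : φ (uGL F[T;T⁻¹]) * monomialGL a b m n * (φ (uGL F[T;T⁻¹]))⁻¹ =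
      monomialGL b a n m := map_uGL_conj_diagGL hW hφ _ _
  obtain ⟨w, hw, hφw⟩ := hφ
  obtain ⟨⟨c, d⟩, hcd⟩ := hW.mem_torus hw ⟨(a', b'), rfl⟩
  have key : monomialGL 1 1 1 0 = monomialGL c d 0 0 *
      (monomialGL a b m n ^ k * monomialGL b a n m ^ l) := by
    rw [← hswap, ← h, ← constGL_diagGL_eq_monomialGL, hcd, ← hφw, diagGL_tUnit_eq_monomialGL,
      ← map_inv, ← map_mul, ← map_mul, ← map_zpow, ← map_zpow, ← map_mul, ← map_mul, ← hdecomp,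
      ← h', MulAut.apply_inv_self, diagGL_tUnit_eq_monomialGL]
  rw [monomialGL_zpow, monomialGL_zpow, monomialGL_mul, monomialGL_mul] at key
  obtain ⟨⟨-, e1⟩, -, e2⟩ := monomialGL_inj key
  have s1 : (m + n) * (k + l) = 1 := by linear_combination -e1 - e2
  have s2 : (m - n) * (k - l) = 1 := by linear_combination -e1 + e2
  refine ⟨a, b, ?_⟩
  rw [h]
  rcases Int.isUnit_iff.mp (IsUnit.of_mul_eq_one _ s1) with p1 | p1 <;>
    rcases Int.isUnit_iff.mp (IsUnit.of_mul_eq_one _ s2) with p2 | p2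
  · obtain rfl : m = 1 := by omega
    obtain rfl : n = 0 := by omega
    exact Or.inl rfl
  · obtain rfl : m = 0 := by omega
    obtain rfl : n = 1 := by omega
    exact Or.inr (Or.inl rfl)
  · obtain rfl : m = 0 := by omega
    obtain rfl : n = -1 := by omega
    exact Or.inr (Or.inr (Or.inr rfl))
  · obtain rfl : m = -1 := by omega
    obtain rfl : n = 0 := by omega
    exact Or.inr (Or.inr (Or.inl rfl))

/-- A normalised automorphism has a type: the sign `ε` and the index `i` record which of the four
possible exponents `(± 1, 0)`, `(0, ± 1)` occurs. -/
theorem exists_isOfType [Finite F] (hW : RepresentsOut F W)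
    {φ : MulAut (GL (Fin 2) F[T;T⁻¹])} (hφ : φ ∈ constRestrict W) :
    ∃ h ε i, IsOfType φ h ε i := by
  have hD : ∀ k : ℤ, diagGL F[T;T⁻¹] (tUnit F ^ k, 1) = monomialGL 1 1 k 0 := fun k => by
    rw [monomialGL, map_one, zpow_zero, mul_one, one_mul]
  obtain ⟨a, b, h | h | h | h⟩ := map_diagGL_tUnit_cases hW hφ
  · refine ⟨⟨diagGL F (a, b), _, rfl⟩, 1, 0, ?_⟩
    rw [IsOfType, h, hD, constGL_diagGL_eq_monomialGL]
    simp [monomialGL_mul]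
  · refine ⟨⟨diagGL F (a, b), _, rfl⟩, 1, 1, ?_⟩
    rw [IsOfType, h, hD, constGL_diagGL_eq_monomialGL, Fin.val_one, pow_one, uGL_conj_monomialGL]
    simp [monomialGL_mul]
  · refine ⟨⟨diagGL F (a, b), _, rfl⟩, -1, 0, ?_⟩
    rw [IsOfType, h, hD, constGL_diagGL_eq_monomialGL]
    simp [monomialGL_mul]
  · refine ⟨⟨diagGL F (a, b), _, rfl⟩, -1, 1, ?_⟩
    rw [IsOfType, h, hD, constGL_diagGL_eq_monomialGL, Fin.val_one, pow_one, uGL_conj_monomialGL]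
    simp [monomialGL_mul]

end TorusStability

/-! ### The action of `Z₂ × Z₂` on the torus -/

section KleinAction

/-- The action of `Z₂ × Z₂` on the diagonal torus by inversion and conjugation by `u`. -/
def kleinAction (R : Type*) [CommRing R] :
    Multiplicative (ZMod 2) × Multiplicative (ZMod 2) →* MulAut (torus R) :=
  (involHom (torusInv R) (torusInv_mul_self R)).noncommCoprod
    (involHom (torusSwap R) (torusSwap_mul_self R))
    fun _ _ => ((torusInv_commute (torusSwap R)).pow_left _).pow_right _

theorem forall_klein {P : Multiplicative (ZMod 2) × Multiplicative (ZMod 2) → Prop}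
    (h1 : P 1) (h2 : P (1, Multiplicative.ofAdd 1)) (h3 : P (Multiplicative.ofAdd 1, 1))
    (h4 : P (Multiplicative.ofAdd 1, Multiplicative.ofAdd 1)) : ∀ s, P s := by
  have h : ∀ s : Multiplicative (ZMod 2) × Multiplicative (ZMod 2), s = 1 ∨
      s = (1, Multiplicative.ofAdd 1) ∨ s = (Multiplicative.ofAdd 1, 1) ∨
      s = (Multiplicative.ofAdd 1, Multiplicative.ofAdd 1) := by decide
  intro s
  rcases h s with rfl | rfl | rfl | rfl
  exacts [h1, h2, h3, h4]

theorem klein_mul_self (s : Multiplicative (ZMod 2) × Multiplicative (ZMod 2)) : s * s = 1 := by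
  revert s
  decide

section

variable {R : Type*} [CommRing R]

theorem involHom_ofAdd_one {M : Type*} [Monoid M] (s : M) (hs : s * s = 1) :
    involHom s hs (Multiplicative.ofAdd 1) = s :=
  pow_one s

theorem kleinAction_apply (a b : Multiplicative (ZMod 2)) :
    kleinAction R (a, b) = involHom (torusInv R) (torusInv_mul_self R) a *
      involHom (torusSwap R) (torusSwap_mul_self R) b :=
  rfl

theorem kleinAction_swap (x : torus R) :
    (kleinAction R (1, Multiplicative.ofAdd 1) x : GL (Fin 2) R) = uGL R * x * (uGL R)⁻¹ := by
  rw [kleinAction_apply, map_one (involHom (torusInv R) _), one_mul, involHom_ofAdd_one]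
  rfl

theorem kleinAction_inv (x : torus R) :
    (kleinAction R (Multiplicative.ofAdd 1, 1) x : GL (Fin 2) R) = (x : GL (Fin 2) R)⁻¹ := by
  rw [kleinAction_apply, map_one (involHom (torusSwap R) _), mul_one, involHom_ofAdd_one]
  rfl

theorem kleinAction_inv_swap (x : torus R) :
    (kleinAction R (Multiplicative.ofAdd 1, Multiplicative.ofAdd 1) x : GL (Fin 2) R) =
      (uGL R * x * (uGL R)⁻¹)⁻¹ := by
  rw [kleinAction_apply, involHom_ofAdd_one, involHom_ofAdd_one]
  rfl

theorem kleinAction_kleinAction (s : Multiplicative (ZMod 2) × Multiplicative (ZMod 2))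
    (x : torus R) : kleinAction R s (kleinAction R s x) = x := by
  rw [← MulAut.mul_apply, ← map_mul, klein_mul_self, map_one, MulAut.one_apply]

theorem kleinAction_commute {f : MulAut (torus R)} (hf : Commute (torusSwap R) f)
    (s : Multiplicative (ZMod 2) × Multiplicative (ZMod 2)) : Commute (kleinAction R s) f := by
  obtain ⟨a, b⟩ := s
  rw [kleinAction_apply]
  exact ((torusInv_commute f).pow_left _).mul_left (hf.pow_left _)

end

variable {F : Type*} [Field F] {W : Subgroup (MulAut (GL (Fin 2) F))}

theorem RepresentsOut.action_apply (hW : RepresentsOut F W)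
    (s : Multiplicative (ZMod 2) × Multiplicative (ZMod 2) × Out (GL (Fin 2) F)) :
    hW.action s = kleinAction F (s.1, s.2.1) *
      restrictHom (torus F) W hW.stabilises (hW.equiv.symm s.2.2) :=
  (mul_assoc _ _ _).symm

/-- The inclusion of the constant diagonal matrices into the diagonal matrices. -/
noncomputable def constTorus (F : Type*) [Field F] : torus F →* torus F[T;T⁻¹] :=
  ((constGL F).comp (torus F).subtype).codRestrict (torus F[T;T⁻¹])
    fun x => (constGL_mem_torus_iff x.1).mpr x.2

theorem coe_constTorus (x : torus F) :
    (constTorus F x : GL (Fin 2) F[T;T⁻¹]) = constGL F x := rfl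

/-- The matrix `δ(t,1)` as an element of the torus. -/
noncomputable def tTorus (F : Type*) [Field F] : torus F[T;T⁻¹] :=
  ⟨diagGL F[T;T⁻¹] (tUnit F, 1), _, rfl⟩

theorem kleinAction_constTorus (s : Multiplicative (ZMod 2) × Multiplicative (ZMod 2))
    (x : torus F) :
    kleinAction F[T;T⁻¹] s (constTorus F x) = constTorus F (kleinAction F s x) := by
  apply Subtype.ext
  rw [coe_constTorus]
  induction s using forall_klein with
  | h1 => rw [map_one, map_one]; rfl
  | h2 =>
    rw [kleinAction_swap, kleinAction_swap, map_mul, map_mul, map_inv, constGL_uGL,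
      coe_constTorus]
  | h3 => rw [kleinAction_inv, kleinAction_inv, map_inv, coe_constTorus]
  | h4 =>
    rw [kleinAction_inv_swap, kleinAction_inv_swap, map_inv, map_mul, map_mul, map_inv,
      constGL_uGL, coe_constTorus]

end KleinAction

/-! ### The embedding of the outer automorphism group -/

section Parameters

variable {F : Type*} [Field F] {W : Subgroup (MulAut (GL (Fin 2) F))}

/-- `γ = (h, s, c)` is the parameter of `φ` if `φ` restricts to the representative of `c` on the
constant matrices and `φ(δ(t,1)) = s(h δ(t,1))`. In terms of the type `(h', ε, i)` of `φ`, the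
component `s` is given by `ε` and `i`, while `h = s(h')`. It is this normalisation of the torus
component that makes the parameter multiplicative. -/
def HasParameter (hW : RepresentsOut F W) (φ : MulAut (GL (Fin 2) F[T;T⁻¹])) (γ : hW.Gamma) :
    Prop :=
  (∀ g, φ (constGL F g) = constGL F ((hW.equiv.symm γ.right.2.2).1 g)) ∧
    φ (tTorus F) = (kleinAction F[T;T⁻¹] (γ.right.1, γ.right.2.1)
      (constTorus F γ.left * tTorus F) : GL (Fin 2) F[T;T⁻¹])

theorem HasParameter.mem_constRestrict {hW : RepresentsOut F W}
    {φ : MulAut (GL (Fin 2) F[T;T⁻¹])} {γ : hW.Gamma} (h : HasParameter hW φ γ) :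
    φ ∈ constRestrict W :=
  ⟨_, (hW.equiv.symm γ.right.2.2).2, h.1⟩

theorem coe_constTorus_mul_tTorus (a b : Fˣ) :
    (constTorus F ⟨diagGL F (a, b), _, rfl⟩ * tTorus F : torus F[T;T⁻¹]) =
      monomialGL a b 1 0 := by
  change constGL F (diagGL F (a, b)) * diagGL F[T;T⁻¹] (tUnit F, 1) = _
  rw [constGL_diagGL_eq_monomialGL, diagGL_tUnit_eq_monomialGL, monomialGL_mul]
  simp

theorem exists_hasParameter [Finite F] (hW : RepresentsOut F W)
    {φ : MulAut (GL (Fin 2) F[T;T⁻¹])} (hφ : φ ∈ constRestrict W) :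
    ∃ γ, HasParameter hW φ γ := by
  have key : ∃ (h : torus F) (s : Multiplicative (ZMod 2) × Multiplicative (ZMod 2)),
      φ (tTorus F) = kleinAction F[T;T⁻¹] s (constTorus F h * tTorus F) := by
    obtain ⟨a, b, h | h | h | h⟩ := map_diagGL_tUnit_cases hW hφ
    · refine ⟨⟨diagGL F (a, b), _, rfl⟩, 1, ?_⟩
      rw [map_one]
      exact h.trans (coe_constTorus_mul_tTorus a b).symm
    · refine ⟨⟨diagGL F (b, a), _, rfl⟩, (1, Multiplicative.ofAdd 1), ?_⟩
      rw [kleinAction_swap, coe_constTorus_mul_tTorus, uGL_conj_monomialGL]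
      exact h
    · refine ⟨⟨diagGL F (a⁻¹, b⁻¹), _, rfl⟩, (Multiplicative.ofAdd 1, 1), ?_⟩
      rw [kleinAction_inv, coe_constTorus_mul_tTorus, monomialGL_inv, inv_inv, inv_inv, neg_zero]
      exact h
    · refine ⟨⟨diagGL F (b⁻¹, a⁻¹), _, rfl⟩,
        (Multiplicative.ofAdd 1, Multiplicative.ofAdd 1), ?_⟩
      rw [kleinAction_inv_swap, coe_constTorus_mul_tTorus, uGL_conj_monomialGL, monomialGL_inv,
        inv_inv, inv_inv, neg_zero]
      exact h
  obtain ⟨h, s, hs⟩ := key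
  obtain ⟨w, hw, hφw⟩ := hφ
  refine ⟨⟨h, s.1, s.2, hW.equiv ⟨w, hw⟩⟩, ?_, hs⟩
  intro g
  change _ = constGL F ((hW.equiv.symm (hW.equiv ⟨w, hw⟩)).1 g)
  rw [MulEquiv.symm_apply_apply, hφw]

theorem HasParameter.mul [Finite F] {hW : RepresentsOut F W}
    {φ φ' : MulAut (GL (Fin 2) F[T;T⁻¹])} {γ γ' : hW.Gamma} (h : HasParameter hW φ γ)
    (h' : HasParameter hW φ' γ') : HasParameter hW (φ * φ') (γ * γ') := by
  have hφ := h.mem_constRestrict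
  obtain ⟨h1, h2⟩ := h
  obtain ⟨h1', h2'⟩ := h'
  refine ⟨fun g => ?_, ?_⟩
  · rw [MulAut.mul_apply, h1', h1, SemidirectProduct.mul_right, Prod.snd_mul, Prod.snd_mul,
      map_mul]
    rfl
  · -- the restriction of `φ` to the torus commutes with the action of `Z₂ × Z₂`
    set φT : MulAut (torus F[T;T⁻¹]) :=
      restrictAut _ φ (map_torus_of_mem_constRestrict hW φ hφ) with hφT
    have hcoe : ∀ x : torus F[T;T⁻¹], φ x = (φT x : GL (Fin 2) F[T;T⁻¹]) := fun x => rfl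
    have hswap : Commute (torusSwap F[T;T⁻¹]) φT := by
      ext x : 1
      apply Subtype.ext
      change uGL F[T;T⁻¹] * φ x.1 * (uGL F[T;T⁻¹])⁻¹ =
        φ (uGL F[T;T⁻¹] * x.1 * (uGL F[T;T⁻¹])⁻¹)
      obtain ⟨⟨a, b⟩, hab⟩ := (φT x).2
      change _ = φ x.1 at hab
      rw [map_mul, map_mul, map_inv, ← hab, map_uGL_conj_diagGL hW hφ, uGL_conj_diagGL]
    have hconst : ∀ x : torus F, φT (constTorus F x) =
        constTorus F (restrictHom (torus F) W hW.stabilises (hW.equiv.symm γ.right.2.2) x) :=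
      fun x => Subtype.ext (h1 x.1)
    have ht : φT (tTorus F) = kleinAction F[T;T⁻¹] (γ.right.1, γ.right.2.1)
        (constTorus F γ.left * tTorus F) := Subtype.ext h2
    have hcomm : ∀ s x, φT (kleinAction F[T;T⁻¹] s x) = kleinAction F[T;T⁻¹] s (φT x) :=
      fun s x => (congrArg (fun f : MulAut (torus F[T;T⁻¹]) => f x)
        (kleinAction_commute hswap s).eq).symm
    rw [MulAut.mul_apply, h2', hcoe]
    congr 1
    -- the factors of `(γ * γ').right` are exchanged, which is harmless in a commutative group
    have hright : ((γ * γ').right.1, (γ * γ').right.2.1) =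
        (γ'.right.1, γ'.right.2.1) * (γ.right.1, γ.right.2.1) := by
      rw [mul_comm]; rfl
    have hleft : (γ * γ').left = kleinAction F (γ.right.1, γ.right.2.1)
        (restrictHom (torus F) W hW.stabilises (hW.equiv.symm γ.right.2.2) γ'.left) * γ.left := by
      rw [SemidirectProduct.mul_left, RepresentsOut.action_apply, torus_comm]
      rfl
    rw [hcomm, map_mul φT, hconst, ht, hright, hleft, map_mul (kleinAction F[T;T⁻¹]),
      MulAut.mul_apply, map_mul (constTorus F), ← kleinAction_constTorus, mul_assoc,
      map_mul _ (kleinAction F[T;T⁻¹] _ (constTorus F _)), kleinAction_kleinAction]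

theorem HasParameter.eq_parameter {hW : RepresentsOut F W} {φ : MulAut (GL (Fin 2) F[T;T⁻¹])}
    {γ γ' : hW.Gamma} (h : HasParameter hW φ γ) (h' : HasParameter hW φ γ') : γ = γ' := by
  have hw : γ.right.2.2 = γ'.right.2.2 := by
    apply hW.equiv.symm.injective
    apply Subtype.ext
    ext g : 1
    exact constGL_injective ((h.1 g).symm.trans (h'.1 g))
  have hklein : ∀ (s : Multiplicative (ZMod 2) × Multiplicative (ZMod 2)) (x y : torus F),
      kleinAction F[T;T⁻¹] s (constTorus F x * tTorus F) = constTorus F y * tTorus F →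
      s = 1 ∧ x = y := by
    rintro s ⟨_, ⟨a, b⟩, rfl⟩ ⟨_, ⟨a', b'⟩, rfl⟩ e
    have e' := congrArg Subtype.val e
    rw [coe_constTorus_mul_tTorus] at e'
    induction s using forall_klein with
    | h1 =>
      rw [map_one, MulAut.one_apply, coe_constTorus_mul_tTorus] at e'
      obtain ⟨⟨rfl, -⟩, rfl, -⟩ := monomialGL_inj e'
      exact ⟨rfl, rfl⟩
    | h2 =>
      rw [kleinAction_swap, coe_constTorus_mul_tTorus, uGL_conj_monomialGL] at e'
      exact absurd (monomialGL_inj e').1.2 (by decide)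
    | h3 =>
      rw [kleinAction_inv, coe_constTorus_mul_tTorus, monomialGL_inv] at e'
      exact absurd (monomialGL_inj e').1.2 (by decide)
    | h4 =>
      rw [kleinAction_inv_swap, coe_constTorus_mul_tTorus, uGL_conj_monomialGL,
        monomialGL_inv] at e'
      exact absurd (monomialGL_inj e').1.2 (by decide)
  have e := Subtype.ext (h.2.symm.trans h'.2)
  have e' := congrArg (kleinAction F[T;T⁻¹] (γ'.right.1, γ'.right.2.1)) e
  rw [kleinAction_kleinAction, ← MulAut.mul_apply, ← map_mul] at e'
  obtain ⟨hs, hl⟩ := hklein _ _ _ e'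
  have hs' : (γ'.right.1, γ'.right.2.1) = (γ.right.1, γ.right.2.1) := by
    have := congrArg (· * (γ.right.1, γ.right.2.1)) hs
    simpa only [mul_assoc, klein_mul_self, mul_one, one_mul] using this
  apply SemidirectProduct.ext hl
  exact Prod.ext (congrArg Prod.fst hs').symm (Prod.ext (congrArg Prod.snd hs').symm hw)

/-- The parameter determines the automorphism, because `GL₂(F[t,t⁻¹])` is generated by the constant
matrices and `δ(t,1)`. -/
theorem HasParameter.eq_automorphism {hW : RepresentsOut F W}
    {φ φ' : MulAut (GL (Fin 2) F[T;T⁻¹])} {γ : hW.Gamma} (h : HasParameter hW φ γ)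
    (h' : HasParameter hW φ' γ) : φ = φ' := by
  have htop : φ.toMonoidHom.eqLocus φ'.toMonoidHom = ⊤ :=
    eq_top_of_constGL_mem (fun g => (h.1 g).trans (h'.1 g).symm) (h.2.trans h'.2.symm)
  ext x : 1
  have hx : x ∈ φ.toMonoidHom.eqLocus φ'.toMonoidHom := by rw [htop]; exact Subgroup.mem_top x
  exact hx

/-- Sending an outer class to the parameter of its unique normalised representative is an injective
homomorphism. -/
theorem exists_injective_hom_gamma [Finite F] (hW : RepresentsOut F W) :
    ∃ Ψ : Out (GL (Fin 2) F[T;T⁻¹]) →* hW.Gamma, Function.Injective Ψ := by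
  have hex : ∀ c : Out (GL (Fin 2) F[T;T⁻¹]), ∃ γ : hW.Gamma, ∃ φ,
      outClass (GL (Fin 2) F[T;T⁻¹]) φ = c ∧ HasParameter hW φ γ := by
    intro c
    obtain ⟨ψ, rfl⟩ := QuotientGroup.mk'_surjective _ c
    obtain ⟨φ, hφ, h⟩ := exists_mem_constRestrict hW ψ
    obtain ⟨γ, hγ⟩ := exists_hasParameter hW hφ
    exact ⟨γ, φ, h, hγ⟩
  choose Ψ Φ hΦ hΨ using hex
  refine ⟨MonoidHom.mk' Ψ fun c d => ?_, fun c d h => ?_⟩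
  · have hmul := (hΨ c).mul (hΨ d)
    have e : Φ (c * d) = Φ c * Φ d := by
      apply eq_of_mem_constRestrict hW (hΨ _).mem_constRestrict hmul.mem_constRestrict
      rw [map_mul, hΦ, hΦ, hΦ]
    exact (hΨ (c * d)).eq_parameter (e ▸ hmul)
  · change Ψ c = Ψ d at h
    rw [← hΦ c, ← hΦ d, (hΨ c).eq_automorphism (h ▸ hΨ d)]

theorem finite_gamma [Finite F] (hW : RepresentsOut F W) : Finite hW.Gamma := by
  have : Finite (MulAut (GL (Fin 2) F)) := Finite.of_injective _ (DFunLike.coe_injective)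
  have : Finite (Out (GL (Fin 2) F)) := Quotient.finite _
  exact Finite.of_equiv _ SemidirectProduct.equivProd.symm

theorem finite_out [Finite F] : Finite (Out (GL (Fin 2) F[T;T⁻¹])) := by
  obtain ⟨W, hW, -⟩ := exists_representsOut F
  obtain ⟨Ψ, hΨ⟩ := exists_injective_hom_gamma hW
  have := finite_gamma hW
  exact Finite.of_injective Ψ hΨ

theorem IsNormalised.mem_constRestrict {φ : MulAut (GL (Fin 2) F[T;T⁻¹])} (h : IsNormalised W φ) :
    φ ∈ constRestrict W := h.restrict

theorem isNormalised_of_mem_constRestrict [Finite F] (hW : RepresentsOut F W)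
    {φ : MulAut (GL (Fin 2) F[T;T⁻¹])} (hφ : φ ∈ constRestrict W) : IsNormalised W φ where
  torus_map := map_torus_of_mem_constRestrict hW φ hφ
  const_map := map_constGL_range_of_mem_constRestrict φ hφ
  restrict := hφ
  type := exists_isOfType hW hφ
  finite_order := by
    -- a power of `φ` has trivial outer class, and then it is trivial by uniqueness
    have := finite_out (F := F)
    obtain ⟨n, hn, h⟩ :=
      (isOfFinOrder_of_finite (outClass (GL (Fin 2) F[T;T⁻¹]) φ)).exists_pow_eq_one
    refine isOfFinOrder_iff_pow_eq_one.mpr ⟨n, hn, ?_⟩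
    apply eq_of_mem_constRestrict hW ((constRestrict W).pow_mem hφ n) (constRestrict W).one_mem
    rw [map_pow, h, map_one]

end Parameters

theorem theorem7 (F : Type*) [Field F] [Finite F] :
    (∃ W : Subgroup (MulAut (GL (Fin 2) F)), RepresentsOut F W ∧
      (Nat.card F ≠ 2 → frobeniusContragredient F ≤ W)) ∧
    (∀ (W : Subgroup (MulAut (GL (Fin 2) F))) (hW : RepresentsOut F W),
      Finite hW.Gamma ∧
      (∃ Ψ : Out (GL (Fin 2) F[T;T⁻¹]) →* hW.Gamma, Function.Injective Ψ) ∧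
      (∀ c : Out (GL (Fin 2) F[T;T⁻¹]),
        ∃! φ : MulAut (GL (Fin 2) F[T;T⁻¹]),
          outClass (GL (Fin 2) F[T;T⁻¹]) φ = c ∧ IsNormalised W φ)) ∧
    Finite (Out (GL (Fin 2) F[T;T⁻¹])) := by
  refine ⟨exists_representsOut F, fun W hW => ⟨finite_gamma hW, exists_injective_hom_gamma hW,
    fun c => ?_⟩, finite_out⟩
  obtain ⟨ψ, rfl⟩ := QuotientGroup.mk'_surjective _ c
  obtain ⟨φ, hφ, h⟩ := exists_mem_constRestrict hW ψ
  refine ⟨φ, ⟨h, isNormalised_of_mem_constRestrict hW hφ⟩, ?_⟩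
  rintro φ' ⟨h', hφ'⟩
  exact eq_of_mem_constRestrict hW hφ'.mem_constRestrict hφ (h'.trans h.symm)
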